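/- Let $n\ge 4$, let $S$ be a Möbius strip, and let $P\subset\partial S$ be a set of $n$ points ("vertices"), labelled $1,\dots,n$ in cyclic order along the boundary circle; labels are read modulo $n$. A simple arc is a path in $S$ whose endpoints are vertices (possibly equal), whose interior avoids $\partial S$, and which has no self-intersections except that its two endpoints may coincide. Arcs are considered unoriented and up to homotopy relative to endpoints; an arc is trivial if it is homotopic, relative to its endpoints, to a vertex or to a boundary edge between consecutive vertices. The full arc complex $\mathcal A$ of $(S,P)$ is the simplicial complex whose $0$-simplices are the homotopy classes of non-trivial simple arcs and whose $k$-simplices are the sets of $k+1$ distinct classes that are pairwise disjoint, i.e. any two of them have representatives that do not meet except possibly at vertices. Let $M_i$ be the class of the b-arc based at $i$ that is homotopic to the whole boundary loop, and let $a_{i+1}^{i}$ be the class of the arc homotopic to the boundary path that runs from $i+1$ through all the vertices $i+1,i+2,\dots,i+n$, ending at the vertex $i+n\equiv i$. A $0$-simplex $v$ of a complex $X$ is dominated if its link is a cone $v'\ast L$ for some $0$-simplex $v'\neq v$ of $X$ and some (possibly empty) subcomplex $L$; an elementary strong collapse replaces $X$ by the complex $X\smallsetminus\{v\}$ of simplices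 not containing a dominated $v$; $X$ strongly collapses onto $Y$ if $Y$ is obtained by finitely many (possibly no) elementary strong collapses, and $X$ is strongly collapsible if it strongly collapses onto a $0$-simplex. Then: 1. $\mathcal A$ is not strongly collapsible. 2. For every $I\subseteq \mathbb Z/n$ and every $J\subseteq\{i : i\in I,\ i+1\in I\}$, the dominated $0$-simplices of $\mathcal A\smallsetminus(\{M_i : i\in I\}\cup\{a_{i+1}^{i} : i\in J\})$ are exactly the $M_j$ with $j\notin I$ and the $a_{i+1}^{i}$ with $i\in I$, $i+1\in I$, $i\notin J$. 3. Put $\mathcal D=\{M_i : i\in\mathbb Z/n\}\cup\{a_{i+1}^{i} : i\in\mathbb Z/n\}$. If $\mathcal A$ strongly collapses onto $Y$, then $Y$ strongly collapses onto $\mathcal A\smallsetminus\mathcal D$; in particular, if $Y$ has no dominated $0$-simplex, then $Y=\mathcal A\smallsetminus\mathcal D$. 4. $\mathcal A\smallsetminus\mathcal D$ has no dominated $0$-simplex and is not a single $0$-simplex. -/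

import Mathlib

/-! ## Strong collapses of simplicial complexes

A simplicial complex with vertices in `V` is a `PreAbstractSimplicialComplex V`: a family of
nonempty finite subsets of `V` closed under passing to nonempty subsets.  An element `v : V` is a
`0`-simplex of `X` when `{v} ∈ X.faces`. -/

namespace StrongCollapse

variable {V : Type*}

open Classical in
/-- The link of the `0`-simplex `v`: the simplices `s` with `v ∉ s` and `s ∪ {v} ∈ X`. -/
def link (X : PreAbstractSimplicialComplex V) (v : V) : PreAbstractSimplicialComplex V where
  faces := {s | s.Nonempty ∧ v ∉ s ∧ insert v s ∈ X.faces}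
  isRelLowerSet_faces := by
    rintro s ⟨hs, hv, hX⟩
    refine ⟨hs, fun t hts ht => ⟨ht, fun h => hv (hts h), ?_⟩⟩
    exact (X.isRelLowerSet_faces hX).2 (Finset.insert_subset_insert v hts)
      (Finset.insert_nonempty v t)

open Classical in
/-- The cone `v ⋈ L` with apex `v` and base `L`: its simplices are `{v}`, the simplices of `L`, and
`s ∪ {v}` for `s ∈ L`. -/
def cone (v : V) (L : PreAbstractSimplicialComplex V) : PreAbstractSimplicialComplex V where
  faces := {s | s = {v} ∨ s ∈ L.faces ∨ ∃ t ∈ L.faces, s = insert v t}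
  isRelLowerSet_faces := by
    rintro s hs
    have hsub : s.Nonempty ∧ (s.erase v ∈ L.faces ∨ s.erase v = ∅ ∨ s ∈ L.faces) := by
      rcases hs with rfl | hs | ⟨t, ht, rfl⟩
      · simp
      · exact ⟨(L.isRelLowerSet_faces hs).1, Or.inr (Or.inr hs)⟩
      · refine ⟨Finset.insert_nonempty v t, ?_⟩
        by_cases he : (insert v t).erase v = ∅
        · exact Or.inr (Or.inl he)
        · refine Or.inl ((L.isRelLowerSet_faces ht).2 ?_ (Finset.nonempty_iff_ne_empty.2 he))
          exact Finset.erase_insert_subset v t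
    refine ⟨hsub.1, fun u hus hu => ?_⟩
    rcases hsub.2 with h | h | h
    · by_cases hvu : v ∈ u
      · by_cases he : u.erase v = ∅
        · left
          rw [← Finset.insert_erase hvu, he]
          simp
        · right; right
          exact ⟨u.erase v, (L.isRelLowerSet_faces h).2 (Finset.erase_subset_erase v hus)
            (Finset.nonempty_iff_ne_empty.2 he), (Finset.insert_erase hvu).symm⟩
      · right; left
        refine (L.isRelLowerSet_faces h).2 (fun x hx => ?_) hu
        exact Finset.mem_erase.2 ⟨fun hxv => hvu (hxv ▸ hx), hus hx⟩
    · left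
      have hsv : s ⊆ {v} := by
        intro x hx
        by_contra hne
        have : x ∈ s.erase v := Finset.mem_erase.2 ⟨by simpa using hne, hx⟩
        simp [h] at this
      exact (Finset.subset_singleton_iff.1 (hus.trans hsv)).resolve_left hu.ne_empty
    · exact Or.inr (Or.inl ((L.isRelLowerSet_faces h).2 hus hu))

/-- The `0`-simplex `v` of `X` is vertex-dominated if its link is a cone `v' ⋈ L` over a (possibly
empty) subcomplex `L` of `X`, for some other `0`-simplex `v'`. -/
def IsDominated (X : PreAbstractSimplicialComplex V) (v : V) : Prop :=
  {v} ∈ X.faces ∧ ∃ v' : V, v' ≠ v ∧ {v'} ∈ X.faces ∧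
    ∃ L : PreAbstractSimplicialComplex V, L ≤ X ∧ {v'} ∉ L.faces ∧ link X v = cone v' L

/-- The complex `X ∖ S`: the simplices of `X` without vertices in `S`. -/
def deleteVertices (X : PreAbstractSimplicialComplex V) (S : Set V) :
    PreAbstractSimplicialComplex V where
  faces := {s | s ∈ X.faces ∧ ∀ v ∈ s, v ∉ S}
  isRelLowerSet_faces := by
    rintro s ⟨hs, hS⟩
    exact ⟨(X.isRelLowerSet_faces hs).1, fun t hts ht =>
      ⟨(X.isRelLowerSet_faces hs).2 hts ht, fun v hv => hS v (hts hv)⟩⟩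

/-- The complex consisting of the single `0`-simplex `v`. -/
def point (v : V) : PreAbstractSimplicialComplex V where
  faces := {{v}}
  isRelLowerSet_faces := by
    rintro s rfl
    exact ⟨Finset.singleton_nonempty v, fun t hts ht =>
      (Finset.subset_singleton_iff.1 hts).resolve_left ht.ne_empty⟩

/-- One elementary strong collapse: the removal of one vertex-dominated `0`-simplex. -/
def Step (X Y : PreAbstractSimplicialComplex V) : Prop :=
  ∃ v : V, IsDominated X v ∧ Y = deleteVertices X {v}

/-- `X` strongly collapses onto `Y` through a finite sequence of elementary strong collapses. -/
def CollapsesTo (X Y : PreAbstractSimplicialComplex V) : Prop :=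
  Relation.ReflTransGen Step X Y

/-- `X` is strongly collapsible if it strongly collapses onto a `0`-simplex. -/
def StronglyCollapsible (X : PreAbstractSimplicialComplex V) : Prop :=
  ∃ v : V, CollapsesTo X (point v)

end StrongCollapse

/-! ## The Möbius strip with marked points on its boundary -/

namespace Mobius

/-- The relation on the infinite strip `ℝ × [-1, 1]` generated by `(x, y) ∼ (x + 1, -y)`. -/
def stripSetoid : Setoid (ℝ × Set.Icc (-1 : ℝ) 1) where
  r p q := ∃ k : ℤ, q.1 = p.1 + k ∧ (q.2 : ℝ) = (-1 : ℝ) ^ k * (p.2 : ℝ)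
  iseqv :=
    { refl := fun p => ⟨0, by simp⟩
      symm := by
        rintro p q ⟨k, h1, h2⟩
        refine ⟨-k, by rw [h1]; push_cast; ring, ?_⟩
        rw [h2, ← mul_assoc, ← zpow_add₀ (by norm_num : (-1 : ℝ) ≠ 0)]
        simp
      trans := by
        rintro p q r ⟨k, h1, h2⟩ ⟨l, h3, h4⟩
        refine ⟨k + l, by rw [h3, h1]; push_cast; ring, ?_⟩
        rw [h4, h2, zpow_add₀ (by norm_num : (-1 : ℝ) ≠ 0)]
        ring }

/-- The Möbius strip, with the quotient topology. -/
abbrev Strip : Type := Quotient stripSetoid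

/-- The boundary point `[(x, 1)]`.  Since `(x, -1) ∼ (x + 1, 1)`, these are all the boundary points,
and `x ↦ [(x, 1)]` is a parametrisation of the boundary circle of period `2`. -/
def boundaryPoint (x : ℝ) : Strip :=
  Quotient.mk stripSetoid (x, ⟨1, by norm_num⟩)

lemma continuous_boundaryPoint : Continuous boundaryPoint :=
  continuous_quotient_mk'.comp (by fun_prop)

/-- The boundary circle of the Möbius strip. -/
def boundary : Set Strip := Set.range boundaryPoint

/-- A path in the Möbius strip. -/
abbrev Curve : Type := C(unitInterval, Strip)

/-- The same path traversed backwards. -/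
def Curve.reverse (a : Curve) : Curve :=
  a.comp ⟨unitInterval.symm, unitInterval.continuous_symm⟩

/-- Homotopy relative to the two endpoints. -/
def HomotopicRelEnds (a b : Curve) : Prop :=
  ContinuousMap.HomotopicRel a b {0, 1}

lemma Curve.reverse_reverse (a : Curve) : Curve.reverse (Curve.reverse a) = a := by
  ext t
  simp [Curve.reverse]

lemma HomotopicRelEnds.reverse {a b : Curve} (h : HomotopicRelEnds a b) :
    HomotopicRelEnds (Curve.reverse a) (Curve.reverse b) := by
  obtain ⟨F⟩ := h
  refine ⟨⟨⟨⟨fun p => F (p.1, unitInterval.symm p.2), by fun_prop⟩, ?_, ?_⟩, ?_⟩⟩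
  · intro t
    simp [Curve.reverse]
  · intro t
    simp [Curve.reverse]
  · intro s t ht
    have ht' : unitInterval.symm t ∈ ({0, 1} : Set unitInterval) := by
      rcases ht with rfl | ht
      · simp
      · rw [Set.mem_singleton_iff] at ht
        subst ht
        simp
    have := F.eq_fst s ht'
    simpa [Curve.reverse] using this

/-- Two paths are identified if they are homotopic relative to their endpoints, after possibly
reversing the direction of one of them. -/
def curveSetoid : Setoid Curve where
  r a b := HomotopicRelEnds a b ∨ HomotopicRelEnds a (Curve.reverse b)
  iseqv :=
    { refl := fun a => Or.inl (ContinuousMap.HomotopicRel.refl a)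
      symm := by
        rintro a b (h | h)
        · exact Or.inl (ContinuousMap.HomotopicRel.symm h)
        · right
          have := HomotopicRelEnds.reverse (ContinuousMap.HomotopicRel.symm h)
          rwa [Curve.reverse_reverse] at this
      trans := by
        rintro a b c (h | h) (k | k)
        · exact Or.inl (ContinuousMap.HomotopicRel.trans h k)
        · exact Or.inr (ContinuousMap.HomotopicRel.trans h k)
        · exact Or.inr (ContinuousMap.HomotopicRel.trans h (HomotopicRelEnds.reverse k))
        · left
          have := HomotopicRelEnds.reverse k
          rw [Curve.reverse_reverse] at this
          exact ContinuousMap.HomotopicRel.trans h this }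

/-- Homotopy classes (relative to endpoints) of unoriented paths in the Möbius strip. -/
abbrev CurveClass : Type := Quotient curveSetoid

/-- The homotopy class of a path. -/
def classOf (a : Curve) : CurveClass := Quotient.mk curveSetoid a

/-- A choice of `n` distinct marked points ("vertices") on the boundary of the Möbius strip, listed
in cyclic order: the `k`-th vertex is `[(pos k, 1)]`, the index `k` being read modulo `n`. -/
structure Marking (n : ℕ) where
  /-- The parameter of the `k`-th vertex, lifted to the universal cover of the boundary circle. -/
  pos : ℤ → ℝ
  strictMono : StrictMono pos
  periodic : ∀ k : ℤ, pos (k + n) = pos k + 2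

namespace Marking

variable {n : ℕ} (P : Marking n)

/-- The `k`-th vertex. -/
def vertex (k : ℤ) : Strip := boundaryPoint (P.pos k)

/-- The set of the `n` vertices. -/
def vertices : Set Strip := Set.range P.vertex

/-- The path along the boundary which starts at the vertex `i` and runs monotonically through the
vertices `i, i + 1, …, j` (for integers `i ≤ j`). -/
def boundaryPath (i j : ℤ) : Curve where
  toFun t := boundaryPoint (P.pos i + (t : ℝ) * (P.pos j - P.pos i))
  continuous_toFun := continuous_boundaryPoint.comp (by fun_prop)

/-- A simple arc: its endpoints are vertices (possibly the same one), its interior avoids the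
boundary, and it has no self-intersection apart from a possible coincidence of the endpoints. -/
structure IsSimpleArc (a : Curve) : Prop where
  source : a 0 ∈ P.vertices
  target : a 1 ∈ P.vertices
  interior : ∀ t : unitInterval, t ≠ 0 → t ≠ 1 → a t ∉ boundary
  simple : ∀ s t : unitInterval, a s = a t → s = t ∨ (s = 0 ∧ t = 1) ∨ (s = 1 ∧ t = 0)

/-- The class of a vertex (a constant path), or of a boundary edge (the portion of the boundary
between two consecutive vertices). -/
def IsTrivial (c : CurveClass) : Prop :=
  ∃ k : ℤ, c = classOf (ContinuousMap.const unitInterval (P.vertex k)) ∨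
    c = classOf (P.boundaryPath k (k + 1))

/-- The homotopy classes of non-trivial simple arcs. -/
def IsArcClass (c : CurveClass) : Prop :=
  ¬ P.IsTrivial c ∧ ∃ a : Curve, P.IsSimpleArc a ∧ classOf a = c

/-- Two homotopy classes of arcs are disjoint if they contain simple arcs which do not meet, except
possibly at vertices. -/
def DisjointClasses (c d : CurveClass) : Prop :=
  ∃ a b : Curve, P.IsSimpleArc a ∧ P.IsSimpleArc b ∧ classOf a = c ∧ classOf b = d ∧
    ∀ s t : unitInterval, a s = b t → a s ∈ P.vertices

/-- The full arc complex of the Möbius strip with the given marked points: the `0`-simplices are the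
homotopy classes of non-trivial simple arcs, the `k`-simplices are the sets of `k + 1` distinct,
pairwise disjoint such classes. -/
def arcComplex : PreAbstractSimplicialComplex CurveClass where
  faces := {s | s.Nonempty ∧ (∀ c ∈ s, P.IsArcClass c) ∧
    ∀ c ∈ s, ∀ d ∈ s, c ≠ d → P.DisjointClasses c d}
  isRelLowerSet_faces := by
    rintro s ⟨h1, h2, h3⟩
    exact ⟨h1, fun t hts ht => ⟨ht, fun c hc => h2 c (hts hc),
      fun c hc d hd => h3 c (hts hc) d (hts hd)⟩⟩

/-- For `i + 2 ≤ j ≤ i + n`, the b-arc joining the vertices `i` and `j` which cuts off the polygon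
with vertices `i, i + 1, …, j`; pushing it across that polygon identifies it up to homotopy with the
boundary path through these vertices. -/
def bArc (i j : ℤ) : CurveClass := classOf (P.boundaryPath i j)

/-- The maximal b-arc `M_i`, with both endpoints at the vertex `i`. -/
def maximalArc (i : ℤ) : CurveClass := P.bArc i (i + n)

/-- The b-arc `a_{i+1}^i` of the adjacent pair `(i, i + 1)`: it cuts off the polygon which contains
all vertices `i + 1, i + 2, …, i + n`, the last one being the vertex `i`. -/
def adjacentArc (i : ℤ) : CurveClass := P.bArc (i + 1) (i + n)

/-- The full arc complex with `M_i` removed for all `i ∈ I` and `a_{i+1}^i` removed for all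
`i ∈ J`. -/
def reducedComplex (I J : Set (ZMod n)) : PreAbstractSimplicialComplex CurveClass :=
  StrongCollapse.deleteVertices P.arcComplex
    ({c | ∃ i : ℤ, (i : ZMod n) ∈ I ∧ c = P.maximalArc i} ∪
      {c | ∃ i : ℤ, (i : ZMod n) ∈ J ∧ c = P.adjacentArc i})

/-- The full arc complex with all the arcs `M_i` and `a_{i+1}^i` removed. -/
def coreComplex : PreAbstractSimplicialComplex CurveClass :=
  P.reducedComplex Set.univ Set.univ

end Marking

end Mobius

/-! The plan is to turn arcs into combinatorial data and then use that the arc complex is a flag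
complex. In a flag complex, `v` is dominated by `v'` exactly when `v'` is disjoint from `v` and from
every arc disjoint from `v`.

The universal cover is a strip, which embeds in the closed upper half-plane as the complement of the
origin. A homotopy class of unoriented arcs is an unordered pair of lifted endpoints up to deck
transformations. Paths with interlaced endpoints on the real line must meet
(`exists_eq_of_interlaced`). Conversely, half circles with non-interlaced endpoints are equal or do
not meet above the line (`OnGeodesic.eq_or_eq`), and deck transformations preserve half circles. So
disjointness becomes a statement about integer indices (`exists_cross_iff`, `disjointClasses_cls`):
an arc is either a `b i j`, which cuts off a polygon, or a `c i j`, which crosses the core.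

The complement of the polygon of `M_j` is a Möbius strip with the single vertex `j`. Every arc
disjoint from `M_j` is then disjoint from the core arc `c j j`, which dominates `M_j`. Beyond
`a_{i+1}^i` lies a Möbius strip with two vertices, where `c (i + 1) i` is crossed only by `M_i` and
`M_{i+1}`; once these are gone it dominates. For every other arc `a` and every candidate `a'`, some
arc disjoint from `a` crosses `a'`. It can be chosen `Short`, hence outside the deleted set, except
for adjacent arcs, where a surviving `M_x` may be needed (`isDominated_reducedComplex_iff_eq`).

Thus collapses can delete only arcs of `𝒟`. The remaining ones can always be deleted too, first the
maximal arcs and then the adjacent ones, so every collapse continues to the core complex. The core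
has no dominated vertex and is not a point, which rules out strong collapsibility. -/

namespace Mobius

open unitInterval

/-! ### Crossing of paths in the closed upper half-plane -/

/-- A continuous angle whose sine stays nonnegative after a shift by `c` cannot leave the half turn
`[c, c + π]`. -/
lemma angle_mem_Icc {θ : ℝ → ℝ} (hθ : Continuous θ) (c : ℝ)
    (hs : ∀ t ∈ Set.Icc (0 : ℝ) 1, 0 ≤ Real.sin (θ t - c))
    (h0 : θ 0 ∈ Set.Icc c (c + Real.pi)) : θ 1 ∈ Set.Icc c (c + Real.pi) := by
  have hpi := Real.pi_pos
  constructor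
  · by_contra! hlt
    -- Truncating at `c - π / 2` keeps the intermediate value in `(c - π, c)`, where the shifted
    -- sine is negative, however far `θ 1` has dropped.
    have hy : max (θ 1) (c - Real.pi / 2) ∈ Set.Icc (θ 1) (θ 0) :=
      ⟨le_max_left _ _, max_le (hlt.le.trans h0.1) (by linarith [h0.1])⟩
    obtain ⟨t, ht, hty⟩ := intermediate_value_Icc' zero_le_one hθ.continuousOn hy
    have h1 : θ t - c < 0 := by
      rw [hty, sub_neg]
      exact max_lt hlt (by linarith)
    have h2 : -Real.pi < θ t - c := by
      rw [hty]
      linarith [le_max_right (θ 1) (c - Real.pi / 2)]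
    exact (Real.sin_neg_of_neg_of_neg_pi_lt h1 h2).not_ge (hs t ht)
  · by_contra! hlt
    have hy : min (θ 1) (c + 3 * Real.pi / 2) ∈ Set.Icc (θ 0) (θ 1) :=
      ⟨le_min (h0.2.trans hlt.le) (by linarith [h0.2]), min_le_left _ _⟩
    obtain ⟨t, ht, hty⟩ := intermediate_value_Icc zero_le_one hθ.continuousOn hy
    have h1 : θ t - c - 2 * Real.pi < 0 := by
      rw [hty]
      linarith [min_le_right (θ 1) (c + 3 * Real.pi / 2)]
    have h2 : -Real.pi < θ t - c - 2 * Real.pi := by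
      have : c + Real.pi < θ t := by
        rw [hty]
        exact lt_min hlt (by linarith)
      linarith
    have h3 := Real.sin_neg_of_neg_of_neg_pi_lt h1 h2
    rw [Real.sin_sub_two_pi] at h3
    exact h3.not_ge (hs t ht)

/-- Two paths in the closed upper half-plane with interlaced endpoints on the real line meet. -/
lemma exists_eq_of_lt_of_lt_of_lt (γ δ : C(I, ℂ)) (hγ : ∀ t, 0 ≤ (γ t).im)
    (hδ : ∀ t, 0 ≤ (δ t).im) {a b c d : ℝ} (ha : γ 0 = a) (hb : γ 1 = b) (hc : δ 0 = c)
    (hd : δ 1 = d) (hac : a < c) (hcb : c < b) (hbd : b < d) : ∃ s t, γ s = δ t := by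
  by_contra! hne
  have hpi := Real.pi_pos
  let pr : ℝ → I := Set.projIcc 0 1 zero_le_one
  have hpr : Continuous pr := continuous_projIcc
  have pr0 : pr 0 = 0 := Set.projIcc_left _
  have pr1 : pr 1 = 1 := Set.projIcc_right _
  let F : C(ℝ × ℝ, ℂ) := ⟨fun x => γ (pr x.1) - δ (pr x.2), by fun_prop⟩
  have hF : ∀ s t, F (s, t) = γ (pr s) - δ (pr t) := fun _ _ => rfl
  have hF0 : ∀ x, F x ≠ 0 := fun x => sub_ne_zero.2 (hne _ _)
  have h00 : F (0, 0) = ((a - c : ℝ) : ℂ) := by rw [hF, pr0, ha, hc]; simp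
  have h10 : F (1, 0) = ((b - c : ℝ) : ℂ) := by rw [hF, pr0, pr1, hb, hc]; simp
  have h01 : F (0, 1) = ((a - d : ℝ) : ℂ) := by rw [hF, pr0, pr1, ha, hd]; simp
  have h11 : F (1, 1) = ((b - d : ℝ) : ℂ) := by rw [hF, pr1, hb, hd]; simp
  -- If the paths never meet, `F` has a continuous logarithm on the simply connected plane. The
  -- angle `(G _).im` is followed along both routes round the unit square from `(0, 0)` to `(1, 1)`:
  -- `F` stays in the upper half-plane on horizontal edges and in the lower one on vertical edges.
  -- One route ends in `[-π, 0]` and the other in `[0, π]`, so the final angle is `0`, although `F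
  -- (1, 1) = b - d` is negative.
  obtain ⟨G, ⟨hG0, hG⟩, -⟩ := Complex.isCoveringMapOn_exp.existsUnique_continuousMap_lifts F
    (a₀ := (0, 0)) (Complex.exp_log (hF0 _)) (fun x => hF0 x)
  have hexp : ∀ x, Complex.exp (G x) = F x := fun x => congrFun hG x
  have him : ∀ x, (F x).im = Real.exp (G x).re * Real.sin (G x).im := fun x => by
    rw [← hexp, Complex.exp_im]
  have hre : ∀ x, (F x).re = Real.exp (G x).re * Real.cos (G x).im := fun x => by
    rw [← hexp, Complex.exp_re]
  have hsin : ∀ x, 0 ≤ (F x).im → 0 ≤ Real.sin (G x).im := fun x hx => by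
    rw [him] at hx
    exact nonneg_of_mul_nonneg_right hx (Real.exp_pos _)
  have hsin' : ∀ x, (F x).im ≤ 0 → Real.sin (G x).im ≤ 0 := fun x hx => by
    rw [him] at hx
    by_contra! h
    exact (mul_pos (Real.exp_pos _) h).not_ge hx
  have hcos : ∀ x, 0 < (F x).re → 0 < Real.cos (G x).im := fun x hx => by
    rw [hre] at hx
    exact pos_of_mul_pos_right hx (Real.exp_pos _).le
  have hcos' : ∀ x, (F x).re < 0 → Real.cos (G x).im < 0 := fun x hx => by
    rw [hre] at hx
    exact neg_of_mul_neg_right hx (Real.exp_pos _).le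
  have hzero : ∀ x (r : ℝ), F x = r → Real.sin (G x).im = 0 := fun x r hx => by
    have := him x
    rw [hx, Complex.ofReal_im] at this
    exact (mul_eq_zero.1 this.symm).resolve_left (Real.exp_pos _).ne'
  have e00 : (G (0, 0)).im = Real.pi := by
    rw [hG0, h00, Complex.log_im, Complex.arg_ofReal_of_neg (by linarith)]
  have top : ∀ t ∈ ({0, 1} : Set ℝ), ∀ s, 0 ≤ (F (s, t)).im := by
    rintro t ht s
    have : (δ (pr t)).im = 0 := by
      rcases ht with rfl | rfl
      · rw [pr0, hc, Complex.ofReal_im]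
      · rw [pr1, hd, Complex.ofReal_im]
    rw [hF, Complex.sub_im, this, sub_zero]
    exact hγ _
  have bot : ∀ s ∈ ({0, 1} : Set ℝ), ∀ t, (F (s, t)).im ≤ 0 := by
    rintro s hs t
    have : (γ (pr s)).im = 0 := by
      rcases hs with rfl | rfl
      · rw [pr0, ha, Complex.ofReal_im]
      · rw [pr1, hb, Complex.ofReal_im]
    rw [hF, Complex.sub_im, this, zero_sub, neg_nonpos]
    exact hδ _
  have e10 : (G (1, 0)).im = 0 := by
    have h1 := angle_mem_Icc (θ := fun s => (G (s, 0)).im) (by fun_prop) 0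
      (fun s _ => by rw [sub_zero]; exact hsin _ (top 0 (by simp) s))
      (by rw [e00]; constructor <;> linarith)
    have h2 := hzero (1, 0) _ h10
    have h3 := hcos (1, 0) (by rw [h10, Complex.ofReal_re]; linarith)
    by_contra hne
    have h4 : 0 < (G (1, 0)).im := lt_of_le_of_ne h1.1 (Ne.symm hne)
    rcases (show (G (1, 0)).im ≤ Real.pi by linarith [h1.2]).lt_or_eq with h5 | h5
    · exact (Real.sin_pos_of_pos_of_lt_pi h4 h5).ne' h2
    · rw [h5, Real.cos_pi] at h3
      linarith
  have e01 : (G (0, 1)).im = Real.pi := by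
    have h1 := angle_mem_Icc (θ := fun t => (G (0, t)).im) (by fun_prop) Real.pi
      (fun t _ => by
        rw [Real.sin_sub_pi]
        exact neg_nonneg.2 (hsin' _ (bot 0 (by simp) t)))
      (by rw [e00]; constructor <;> linarith)
    have h2 := hzero (0, 1) _ h01
    have h3 := hcos' (0, 1) (by rw [h01, Complex.ofReal_re]; linarith)
    by_contra hne
    have h4 : 0 < (G (0, 1)).im - Real.pi := sub_pos.2 (lt_of_le_of_ne h1.1 (Ne.symm hne))
    rcases (show (G (0, 1)).im - Real.pi ≤ Real.pi by linarith [h1.2]).lt_or_eq with h5 | h5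
    · have := Real.sin_pos_of_pos_of_lt_pi h4 h5
      rw [Real.sin_sub_pi, h2] at this
      linarith
    · rw [show (G (0, 1)).im = 2 * Real.pi by linarith, Real.cos_two_pi] at h3
      linarith
  have m1 := angle_mem_Icc (θ := fun t => (G (1, t)).im) (by fun_prop) (-Real.pi)
      (fun t _ => by
        rw [sub_neg_eq_add, Real.sin_add_pi]
        exact neg_nonneg.2 (hsin' _ (bot 1 (by simp) t)))
      (by rw [e10]; constructor <;> linarith)
  have m2 := angle_mem_Icc (θ := fun s => (G (s, 1)).im) (by fun_prop) 0
      (fun s _ => by rw [sub_zero]; exact hsin _ (top 1 (by simp) s))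
      (by rw [e01]; constructor <;> linarith)
  have h3 := hcos' (1, 1) (by rw [h11, Complex.ofReal_re]; linarith)
  rw [show (G (1, 1)).im = 0 by linarith [m1.2, m2.1], Real.cos_zero] at h3
  linarith

/-- The pairs `{a, b}` and `{c, d}` of real numbers separate each other. -/
def Interlaced (a b c d : ℝ) : Prop := (c - a) * (c - b) * ((d - a) * (d - b)) < 0

/-- Two paths in the closed upper half-plane with interlaced endpoints on the real line meet. -/
lemma exists_eq_of_interlaced (γ δ : C(I, ℂ)) (hγ : ∀ t, 0 ≤ (γ t).im)
    (hδ : ∀ t, 0 ≤ (δ t).im) {a b c d : ℝ} (ha : γ 0 = a) (hb : γ 1 = b) (hc : δ 0 = c)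
    (hd : δ 1 = d) (h : Interlaced a b c d) : ∃ s t, γ s = δ t := by
  let R : C(I, I) := ⟨σ, continuous_symm⟩
  wlog hab : a ≤ b generalizing a b γ
  · obtain ⟨s, t, hst⟩ := this (γ.comp R) (fun t => hγ _) (a := b) (b := a) (by simp [R, hb])
      (by simp [R, ha]) (by unfold Interlaced at *; linarith) (le_of_not_ge hab)
    exact ⟨_, _, hst⟩
  wlog hcd : c ≤ d generalizing c d δ
  · obtain ⟨s, t, hst⟩ := this (δ.comp R) (fun t => hδ _) (c := d) (d := c) (by simp [R, hd])
      (by simp [R, hc]) (by unfold Interlaced at *; linarith) (le_of_not_ge hcd)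
    exact ⟨_, _, hst⟩
  unfold Interlaced at h
  -- The sign says that exactly one of `c`, `d` lies between `a` and `b`; with both pairs sorted,
  -- this leaves two orderings, which differ by exchanging the paths.
  rcases mul_neg_iff.1 h with ⟨h1, h2⟩ | ⟨h1, h2⟩
  · have hd' : d < b := by
      by_contra! hh
      nlinarith [mul_nonneg (show 0 ≤ d - a by linarith) (sub_nonneg.2 hh)]
    have had : a < d := by
      by_contra! hh
      nlinarith [mul_nonneg (sub_nonneg.2 hh) (show 0 ≤ b - d by linarith)]
    have hca : c < a := by
      by_contra! hh
      nlinarith [mul_nonneg (sub_nonneg.2 hh) (show 0 ≤ b - c by linarith)]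
    obtain ⟨s, t, hst⟩ := exists_eq_of_lt_of_lt_of_lt δ γ hδ hγ hc hd ha hb hca had hd'
    exact ⟨t, s, hst.symm⟩
  · have hac : a < c := by
      by_contra! hh
      nlinarith [mul_nonneg (sub_nonneg.2 hh) (show 0 ≤ b - c by linarith)]
    have hcb : c < b := by
      by_contra! hh
      nlinarith [mul_nonneg (sub_nonneg.2 hh) (show 0 ≤ c - a by linarith)]
    have hbd : b < d := by
      by_contra! hh
      nlinarith [mul_nonneg (sub_nonneg.2 hh) (show 0 ≤ d - a by linarith)]
    exact exists_eq_of_lt_of_lt_of_lt γ δ hγ hδ ha hb hc hd hac hcb hbd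

end Mobius

/-! ### Universal cover and classification of path classes -/

namespace Mobius

open unitInterval

/-- The universal cover of the Möbius strip. -/
abbrev Cover : Type := ℝ × Set.Icc (-1 : ℝ) 1

/-- The covering projection. -/
def proj (p : Cover) : Strip := Quotient.mk stripSetoid p

/-- The deck transformation `(x, y) ↦ (x + k, (-1) ^ k y)`. -/
noncomputable def deck (k : ℤ) (p : Cover) : Cover :=
  (p.1 + k, ⟨(-1) ^ k * (p.2 : ℝ), abs_le.1 (by
    rw [abs_mul, abs_zpow, abs_neg, abs_one, one_zpow, one_mul]
    exact abs_le.2 p.2.2)⟩)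

@[simp] lemma deck_fst (k : ℤ) (p : Cover) : (deck k p).1 = p.1 + k := rfl

@[simp] lemma deck_snd (k : ℤ) (p : Cover) : ((deck k p).2 : ℝ) = (-1) ^ k * (p.2 : ℝ) := rfl

lemma cover_ext {p q : Cover} (h1 : p.1 = q.1) (h2 : (p.2 : ℝ) = q.2) : p = q :=
  Prod.ext h1 (Subtype.ext h2)

lemma deck_zero (p : Cover) : deck 0 p = p := cover_ext (by simp) (by simp)

lemma deck_add (k l : ℤ) (p : Cover) : deck (k + l) p = deck k (deck l p) :=
  cover_ext (by simp; ring) (by simp [zpow_add₀ (by norm_num : (-1 : ℝ) ≠ 0), mul_assoc])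

lemma deck_neg_deck (k : ℤ) (p : Cover) : deck (-k) (deck k p) = p := by
  rw [← deck_add, neg_add_cancel, deck_zero]

lemma continuous_deck (k : ℤ) : Continuous (deck k) := by
  unfold deck
  fun_prop

lemma proj_eq_proj_iff {p q : Cover} : proj p = proj q ↔ ∃ k : ℤ, q = deck k p := by
  unfold proj
  rw [Quotient.eq]
  exact exists_congr fun k => ⟨fun h => cover_ext h.1 h.2, fun h => by rw [h]; exact ⟨rfl, rfl⟩⟩

@[simp] lemma proj_deck (k : ℤ) (p : Cover) : proj (deck k p) = proj p :=
  (proj_eq_proj_iff.2 ⟨k, rfl⟩).symm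

lemma deck_injective {k l : ℤ} {p : Cover} (h : deck k p = deck l p) : k = l := by
  have := congrArg Prod.fst h
  simpa using this

lemma isCoveringMap_proj : IsCoveringMap proj := by
  let : AddAction ℤ Cover :=
    { vadd := deck
      zero_vadd := deck_zero
      add_vadd := deck_add }
  have key : IsAddQuotientCoveringMap proj ℤ :=
    { toIsQuotientMap := isQuotientMap_quotient_mk'
      continuous_const_vadd := continuous_deck
      apply_eq_iff_mem_orbit := by
        intro p q
        rw [eq_comm, proj_eq_proj_iff]
        exact exists_congr fun k => eq_comm
      disjoint := by
        intro p
        -- A vertical band of width `1` is disjoint from its nontrivial translates, which are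
        -- shifted by at least `1`.
        refine ⟨Prod.fst ⁻¹' Metric.ball p.1 (1 / 2),
          continuous_fst.continuousAt.preimage_mem_nhds (Metric.ball_mem_nhds _ (by norm_num)), ?_⟩
        rintro k ⟨_, ⟨q, hq, rfl⟩, hk⟩
        have h1 : |q.1 - p.1| < 1 / 2 := hq
        have h2 : |q.1 + k - p.1| < 1 / 2 := hk
        rw [abs_lt] at h1 h2
        have h3 : (k : ℝ) < 1 := by linarith
        have h4 : (-1 : ℝ) < k := by linarith
        have h5 : k < 1 := by exact_mod_cast h3
        have h6 : -1 < k := by exact_mod_cast h4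
        lia }
  exact key.isCoveringMap

lemma continuous_proj : Continuous proj := isCoveringMap_proj.continuous

instance : ContractibleSpace (Set.Icc (-1 : ℝ) 1) :=
  (convex_Icc (-1 : ℝ) 1).contractibleSpace ⟨0, by norm_num⟩

/-- The path `a` has a lift to the universal cover that runs from `p` to `q`. -/
def Joins (a : Curve) (p q : Cover) : Prop :=
  ∃ γ : C(I, Cover), (∀ t, proj (γ t) = a t) ∧ γ 0 = p ∧ γ 1 = q

lemma exists_joins {a : Curve} {p : Cover} (h : a 0 = proj p) : ∃ q, Joins a p q := by
  obtain ⟨γ, h1, h2⟩ := isCoveringMap_proj.exists_path_lifts a p h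
  exact ⟨γ 1, γ, congrFun h1, h2, rfl⟩

lemma Joins.source {a : Curve} {p q : Cover} (h : Joins a p q) : a 0 = proj p := by
  obtain ⟨γ, h1, rfl, rfl⟩ := h
  exact (h1 0).symm

lemma Joins.target {a : Curve} {p q : Cover} (h : Joins a p q) : a 1 = proj q := by
  obtain ⟨γ, h1, rfl, rfl⟩ := h
  exact (h1 1).symm

lemma Joins.deck {a : Curve} {p q : Cover} (h : Joins a p q) (k : ℤ) :
    Joins a (deck k p) (deck k q) := by
  obtain ⟨γ, h1, rfl, rfl⟩ := h
  exact ⟨⟨fun t => Mobius.deck k (γ t), (continuous_deck k).comp γ.continuous⟩,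
    fun t => by simp [h1], rfl, rfl⟩

lemma Joins.reverse {a : Curve} {p q : Cover} (h : Joins a p q) :
    Joins (Curve.reverse a) q p := by
  obtain ⟨γ, h1, rfl, rfl⟩ := h
  exact ⟨γ.comp ⟨σ, continuous_symm⟩, fun t => h1 _, by simp, by simp⟩

lemma Joins.of_homotopic {a b : Curve} {p q : Cover} (h : Joins a p q)
    (hab : HomotopicRelEnds a b) : Joins b p q := by
  have ha := h.source
  have hb : b 0 = proj p := by
    obtain ⟨F⟩ := hab
    rw [← ha, ← F.fst_eq_snd (by simp : (0 : I) ∈ ({0, 1} : Set I))]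
  obtain ⟨γ, h1, h2, rfl⟩ := h
  refine ⟨isCoveringMap_proj.liftPath b p hb, congrFun (isCoveringMap_proj.liftPath_lifts b p hb),
    isCoveringMap_proj.liftPath_zero b p hb, ?_⟩
  rw [← isCoveringMap_proj.liftPath_apply_one_eq_of_homotopicRel hab p ha hb,
    ← (isCoveringMap_proj.eq_liftPath_iff' ha).2 ⟨funext h1, h2⟩]

/-- The cover is simply connected, so the two lifts are homotopic relative to their ends, and the
homotopy projects. -/
lemma Joins.homotopic {a b : Curve} {p q : Cover} (ha : Joins a p q) (hb : Joins b p q) :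
    HomotopicRelEnds a b := by
  obtain ⟨γ, h1, h2, h3⟩ := ha
  obtain ⟨δ, k1, k2, k3⟩ := hb
  have h := SimplyConnectedSpace.paths_homotopic (⟨γ, h2, h3⟩ : Path p q) ⟨δ, k2, k3⟩
  have h' : γ.HomotopicRel δ {0, 1} := h
  have := (isCoveringMap_proj.homotopicRel_iff_comp ⟨0, by simp, h2.trans k2.symm⟩).1 h'
  have e1 : (⟨proj, continuous_proj⟩ : C(Cover, Strip)).comp γ = a := ContinuousMap.ext h1
  have e2 : (⟨proj, continuous_proj⟩ : C(Cover, Strip)).comp δ = b := ContinuousMap.ext k1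
  rwa [e1, e2] at this

lemma Joins.exists_deck {a : Curve} {p q r s : Cover} (h : Joins a p q) (h' : Joins a r s) :
    ∃ k, r = Mobius.deck k p ∧ s = Mobius.deck k q := by
  obtain ⟨k, rfl⟩ := proj_eq_proj_iff.1 (h.source.symm.trans h'.source)
  refine ⟨k, rfl, ?_⟩
  obtain ⟨γ, h1, h2, h3⟩ := h.deck k
  obtain ⟨δ, k1, k2, rfl⟩ := h'
  rw [← h3]
  have : a 0 = proj (Mobius.deck k p) := by rw [h.source, proj_deck]
  rw [(isCoveringMap_proj.eq_liftPath_iff' this).2 ⟨funext h1, h2⟩,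
    (isCoveringMap_proj.eq_liftPath_iff' this).2 ⟨funext k1, k2⟩]

/-- The class of the paths that have a lift running from `p` to `q`. -/
noncomputable def arcClass (p q : Cover) : CurveClass :=
  classOf ((PathConnectedSpace.somePath p q).map continuous_proj).toContinuousMap

lemma joins_somePath (p q : Cover) :
    Joins ((PathConnectedSpace.somePath p q).map continuous_proj).toContinuousMap p q :=
  ⟨(PathConnectedSpace.somePath p q).toContinuousMap, fun _ => rfl, by simp, by simp⟩

lemma Joins.classOf_eq {a : Curve} {p q : Cover} (h : Joins a p q) : classOf a = arcClass p q :=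
  Quotient.sound (Or.inl (h.homotopic (joins_somePath p q)))

lemma arcClass_symm (p q : Cover) : arcClass p q = arcClass q p := by
  rw [← (joins_somePath p q).classOf_eq, ← (joins_somePath p q).reverse.classOf_eq]
  refine Quotient.sound (Or.inr ?_)
  rw [Curve.reverse_reverse]
  exact ContinuousMap.HomotopicRel.refl _

lemma arcClass_deck (k : ℤ) (p q : Cover) : arcClass (deck k p) (deck k q) = arcClass p q := by
  rw [← (joins_somePath p q).classOf_eq, ((joins_somePath p q).deck k).classOf_eq]

lemma Joins.of_classOf_eq {a : Curve} {p q : Cover} (h : classOf a = arcClass p q) :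
    Joins a p q ∨ Joins a q p := by
  rcases Quotient.exact h with h | h
  · exact Or.inl ((joins_somePath p q).of_homotopic h.symm)
  · exact Or.inr ((joins_somePath p q).reverse.of_homotopic h.symm)

/-- Endpoints of lifts are homotopy invariants, and two lifts of one path differ by a deck
transformation; reversal accounts for the second alternative. -/
lemma arcClass_eq_arcClass_iff {p q r s : Cover} : arcClass p q = arcClass r s ↔
    ∃ k, (r = deck k p ∧ s = deck k q) ∨ (r = deck k q ∧ s = deck k p) := by
  constructor
  · intro h
    have h1 := joins_somePath p q
    rcases Joins.of_classOf_eq (h1.classOf_eq.trans h) with h2 | h2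
    · obtain ⟨k, h3⟩ := h1.exists_deck h2
      exact ⟨k, Or.inl h3⟩
    · obtain ⟨k, h3, h4⟩ := h1.exists_deck h2
      exact ⟨k, Or.inr ⟨h4, h3⟩⟩
  · rintro ⟨k, ⟨rfl, rfl⟩ | ⟨rfl, rfl⟩⟩
    · rw [arcClass_deck]
    · rw [arcClass_deck, arcClass_symm]

end Mobius

/-! ### Half-plane model and half circles -/

namespace Mobius

open unitInterval

/-- The real coordinate of the embedding of the universal cover into the closed upper half-plane. -/
noncomputable def hpRe (p : Cover) : ℝ := Real.exp p.1 * p.2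

/-- The imaginary coordinate of the embedding of the universal cover into the closed upper
half-plane. -/
noncomputable def hpIm (p : Cover) : ℝ := Real.exp p.1 * √(1 - (p.2 : ℝ) ^ 2)

lemma continuous_hpRe : Continuous hpRe := by
  unfold hpRe
  fun_prop

lemma continuous_hpIm : Continuous hpIm := by
  unfold hpIm
  fun_prop

lemma hpIm_nonneg (p : Cover) : 0 ≤ hpIm p := by
  unfold hpIm
  positivity

lemma snd_sq_le_one (p : Cover) : (p.2 : ℝ) ^ 2 ≤ 1 := by
  obtain ⟨h1, h2⟩ := p.2.2
  nlinarith

lemma hpRe_sq_add_hpIm_sq (p : Cover) : hpRe p ^ 2 + hpIm p ^ 2 = Real.exp p.1 ^ 2 := by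
  unfold hpRe hpIm
  rw [mul_pow, mul_pow, Real.sq_sqrt (by linarith [snd_sq_le_one p])]
  ring

lemma hp_injective {p q : Cover} (h1 : hpRe p = hpRe q) (h2 : hpIm p = hpIm q) : p = q := by
  have h : Real.exp p.1 = Real.exp q.1 := by
    have := hpRe_sq_add_hpIm_sq p
    rw [h1, h2, hpRe_sq_add_hpIm_sq q] at this
    exact (pow_left_inj₀ (Real.exp_pos _).le (Real.exp_pos _).le two_ne_zero).1 this.symm
  refine cover_ext (Real.exp_injective h) ?_
  unfold hpRe at h1
  rw [h] at h1
  exact mul_left_cancel₀ (Real.exp_pos _).ne' h1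

lemma hpIm_eq_zero_iff {p : Cover} : hpIm p = 0 ↔ (p.2 : ℝ) = 1 ∨ (p.2 : ℝ) = -1 := by
  unfold hpIm
  rw [mul_eq_zero, or_iff_right (Real.exp_pos _).ne',
    Real.sqrt_eq_zero (by linarith [snd_sq_le_one p]), sub_eq_zero, eq_comm]
  simp

/-- With `hpIm_deck`: the generator of the deck group acts as `w ↦ -e * conj w`, a glide reflection
of the hyperbolic plane, so half circles go to half circles. -/
lemma hpRe_deck (k : ℤ) (p : Cover) : hpRe (deck k p) = (-1) ^ k * Real.exp k * hpRe p := by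
  unfold hpRe
  rw [deck_fst, deck_snd, Real.exp_add]
  ring

lemma hpIm_deck (k : ℤ) (p : Cover) : hpIm (deck k p) = Real.exp k * hpIm p := by
  unfold hpIm
  rw [deck_fst, deck_snd, Real.exp_add, mul_pow, ← zpow_natCast ((-1 : ℝ) ^ k), ← zpow_mul,
    mul_comm k, zpow_mul]
  simp
  ring

/-- A point of the universal cover lying over the boundary of the strip. -/
def OnBoundary (p : Cover) : Prop := hpIm p = 0

lemma OnBoundary.deck {p : Cover} (h : OnBoundary p) (k : ℤ) : OnBoundary (deck k p) := by
  unfold OnBoundary at *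
  rw [hpIm_deck, h, mul_zero]

lemma OnBoundary.hpRe_ne_zero {p : Cover} (h : OnBoundary p) : hpRe p ≠ 0 := by
  intro h'
  have := hpRe_sq_add_hpIm_sq p
  rw [h, h'] at this
  have := Real.exp_pos p.1
  nlinarith

lemma OnBoundary.eq_of_hpRe_eq {p q : Cover} (hp : OnBoundary p) (hq : OnBoundary q)
    (h : hpRe p = hpRe q) : p = q := hp_injective h (hp.trans hq.symm)

lemma proj_mem_boundary_iff {p : Cover} : proj p ∈ boundary ↔ OnBoundary p := by
  constructor
  · rintro ⟨x, hx⟩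
    obtain ⟨k, rfl⟩ := proj_eq_proj_iff.1 (show proj (x, ⟨1, by norm_num⟩) = proj p from hx)
    exact OnBoundary.deck (hpIm_eq_zero_iff.2 (Or.inl rfl)) k
  · intro h
    rcases hpIm_eq_zero_iff.1 h with h | h
    · exact ⟨p.1, congrArg proj (cover_ext rfl h.symm)⟩
    · refine ⟨p.1 - 1, proj_eq_proj_iff.2 ⟨1, cover_ext ?_ ?_⟩⟩
      · simp
      · simp [h]

/-- The boundary points `p`, `q` separate the boundary points `r`, `s` on the boundary of the
closed half-plane. -/
def Cross (p q r s : Cover) : Prop := Interlaced (hpRe p) (hpRe q) (hpRe r) (hpRe s)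

lemma Cross.swap_left {p q r s : Cover} (h : Cross p q r s) : Cross q p r s := by
  unfold Cross Interlaced at *
  linarith

lemma Cross.swap_right {p q r s : Cover} (h : Cross p q r s) : Cross p q s r := by
  unfold Cross Interlaced at *
  linarith

lemma Cross.ne {p q r s : Cover} (h : Cross p q r s) : p ≠ r ∧ p ≠ s ∧ q ≠ r ∧ q ≠ s := by
  unfold Cross Interlaced at h
  refine ⟨?_, ?_, ?_, ?_⟩ <;> rintro rfl <;> simp at h

lemma Cross.exists_eq (γ δ : C(I, Cover)) (hp : OnBoundary (γ 0)) (hq : OnBoundary (γ 1))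
    (hr : OnBoundary (δ 0)) (hs : OnBoundary (δ 1)) (h : Cross (γ 0) (γ 1) (δ 0) (δ 1)) :
    ∃ s t, γ s = δ t := by
  let f : C(Cover, ℂ) := ⟨fun p => hpRe p + hpIm p * Complex.I, by
    have := continuous_hpRe
    have := continuous_hpIm
    fun_prop⟩
  have hre : ∀ p, (f p).re = hpRe p := fun p => by simp [f]
  have him : ∀ p, (f p).im = hpIm p := fun p => by simp [f]
  have hb : ∀ p, OnBoundary p → f p = hpRe p := fun p hp => by
    simp only [OnBoundary] at hp
    simp [f, hp]
  obtain ⟨s, t, hst⟩ := exists_eq_of_interlaced (f.comp γ) (f.comp δ)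
    (fun t => by rw [ContinuousMap.comp_apply, him]; exact hpIm_nonneg _)
    (fun t => by rw [ContinuousMap.comp_apply, him]; exact hpIm_nonneg _)
    (hb _ hp) (hb _ hq) (hb _ hr) (hb _ hs) h
  rw [ContinuousMap.comp_apply, ContinuousMap.comp_apply] at hst
  exact ⟨s, t, hp_injective (by rw [← hre, hst, hre]) (by rw [← him, hst, him])⟩

/-- The point `z` lies on the half circle with the endpoints `p` and `q`. -/
def OnGeodesic (p q z : Cover) : Prop :=
  (hpRe z - hpRe p) * (hpRe q - hpRe z) = hpIm z ^ 2

lemma OnGeodesic.deck {p q z : Cover} (h : OnGeodesic p q z) (k : ℤ) :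
    OnGeodesic (deck k p) (deck k q) (deck k z) := by
  unfold OnGeodesic at *
  simp only [hpRe_deck, hpIm_deck]
  have h1 : ((-1 : ℝ) ^ k) ^ 2 = 1 := by
    rw [← zpow_natCast, ← zpow_mul, mul_comm, zpow_mul]
    simp
  linear_combination ((-1 : ℝ) ^ k) ^ 2 * Real.exp k ^ 2 * h + Real.exp k ^ 2 * hpIm z ^ 2 * h1

/-- Let `u + iv` be the common point and `σ = r + s - p - q` on real coordinates. Subtracting the
circle equations shows that `(x - p) * (x - q)` equals `(r - u) * σ` at `x = r` and `(s - u) * σ` at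
`x = s`. Their product is `-v ^ 2 * σ ^ 2`, negative unless `σ = 0`, so without interlacing the
endpoints coincide. -/
lemma OnGeodesic.eq_or_eq {p q r s z : Cover} (hp : OnBoundary p) (hq : OnBoundary q)
    (hr : OnBoundary r) (hs : OnBoundary s) (h : OnGeodesic p q z) (h' : OnGeodesic r s z)
    (hz : ¬ OnBoundary z) (hc : ¬ Cross p q r s) : (r = p ∧ s = q) ∨ (r = q ∧ s = p) := by
  unfold OnGeodesic at h h'
  have hv : 0 < hpIm z ^ 2 := by
    unfold OnBoundary at hz
    positivity
  unfold Cross Interlaced at hc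
  push Not at hc
  set u := hpRe z
  have hrs : r ≠ s := by
    rintro rfl
    nlinarith [sq_nonneg (u - hpRe r)]
  -- the difference of the two quadratic equations is linear and vanishes at `u`
  have e1 : (hpRe r - hpRe p) * (hpRe r - hpRe q) =
      (hpRe r - u) * (hpRe r + hpRe s - hpRe p - hpRe q) := by linear_combination h' - h
  have e2 : (hpRe s - hpRe p) * (hpRe s - hpRe q) =
      (hpRe s - u) * (hpRe r + hpRe s - hpRe p - hpRe q) := by linear_combination h' - h
  have e3 : hpRe r + hpRe s - hpRe p - hpRe q = 0 := by
    by_contra hne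
    have : 0 < (hpRe r + hpRe s - hpRe p - hpRe q) ^ 2 := by positivity
    rw [e1, e2] at hc
    nlinarith [mul_pos hv this]
  rw [e3, mul_zero, mul_eq_zero, sub_eq_zero, sub_eq_zero] at e1 e2
  rcases e1 with e1 | e1 <;> rcases e2 with e2 | e2
  · exact absurd (hr.eq_of_hpRe_eq hs (e1.trans e2.symm)) hrs
  · exact Or.inl ⟨hr.eq_of_hpRe_eq hp e1, hs.eq_of_hpRe_eq hq e2⟩
  · exact Or.inr ⟨hr.eq_of_hpRe_eq hq e1, hs.eq_of_hpRe_eq hp e2⟩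
  · exact absurd (hr.eq_of_hpRe_eq hs (e1.trans e2.symm)) hrs

/-- The inverse of the embedding into the half-plane. -/
noncomputable def ofHalfPlane (w : ℂ) : Cover :=
  (Real.log ‖w‖, ⟨w.re / ‖w‖, abs_le.1 (by
    rw [abs_div, abs_norm]
    exact div_le_one_of_le₀ (Complex.abs_re_le_norm w) (norm_nonneg w))⟩)

lemma hpRe_ofHalfPlane {w : ℂ} (hw : w ≠ 0) : hpRe (ofHalfPlane w) = w.re := by
  have := norm_pos_iff.2 hw
  unfold hpRe ofHalfPlane
  rw [Real.exp_log this]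
  field_simp

lemma hpIm_ofHalfPlane {w : ℂ} (hw : w ≠ 0) (him : 0 ≤ w.im) : hpIm (ofHalfPlane w) = w.im := by
  have := norm_pos_iff.2 hw
  have h := hpRe_sq_add_hpIm_sq (ofHalfPlane w)
  rw [hpRe_ofHalfPlane hw, show (ofHalfPlane w).1 = Real.log ‖w‖ from rfl, Real.exp_log this,
    ← Complex.normSq_eq_norm_sq, Complex.normSq_apply] at h
  exact (pow_left_inj₀ (hpIm_nonneg _) him two_ne_zero).1 (by linarith)

/-- Two boundary points are joined by a path along a half circle. -/
lemma exists_geodesic {p q : Cover} (hp : OnBoundary p) (hq : OnBoundary q) (hpq : p ≠ q) :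
    ∃ γ : C(I, Cover), γ 0 = p ∧ γ 1 = q ∧ Function.Injective γ ∧
      (∀ t, OnBoundary (γ t) → t = 0 ∨ t = 1) ∧ ∀ t, OnGeodesic p q (γ t) := by
  have hne : hpRe q - hpRe p ≠ 0 := fun h => hpq (hp.eq_of_hpRe_eq hq (by linarith))
  -- The real part is affine in `t`, which gives injectivity; the height is then dictated by the
  -- circle equation.
  let w : I → ℂ := fun t =>
    ⟨hpRe p + t * (hpRe q - hpRe p), |hpRe q - hpRe p| * √(t * (1 - t))⟩
  have hw : Continuous w := by
    have h1 : Continuous fun t : I => hpRe p + t * (hpRe q - hpRe p) := by fun_prop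
    have h2 : Continuous fun t : I => |hpRe q - hpRe p| * √(t * (1 - t)) := by fun_prop
    exact Complex.equivRealProdCLM.symm.continuous.comp (h1.prodMk h2)
  have him : ∀ t, 0 ≤ (w t).im := fun t => mul_nonneg (abs_nonneg _) (Real.sqrt_nonneg _)
  have hnn : ∀ t : I, 0 ≤ (t : ℝ) * (1 - t) := fun t =>
    mul_nonneg t.2.1 (sub_nonneg.2 t.2.2)
  have hend : ∀ t, (w t).im = 0 → t = 0 ∨ t = 1 := by
    intro t ht
    rcases mul_eq_zero.1 ht with h | h
    · exact absurd (abs_eq_zero.1 h) hne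
    · rw [Real.sqrt_eq_zero (hnn t)] at h
      rcases mul_eq_zero.1 h with h | h
      · exact Or.inl (Subtype.ext h)
      · exact Or.inr (Subtype.ext (show (t : ℝ) = 1 by linarith))
  have re0 : (w 0).re = hpRe p := by simp [w]
  have re1 : (w 1).re = hpRe q := by simp [w]
  have im0 : (w 0).im = 0 := by simp [w]
  have im1 : (w 1).im = 0 := by simp [w]
  -- The origin is the one point of the half-plane missed by the cover. The path meets the real line
  -- only at its ends, which are nonzero.
  have hw0 : ∀ t, w t ≠ 0 := by
    intro t ht
    rcases hend t (by rw [ht]; rfl) with rfl | rfl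
    · rw [ht, Complex.zero_re] at re0
      exact hp.hpRe_ne_zero re0.symm
    · rw [ht, Complex.zero_re] at re1
      exact hq.hpRe_ne_zero re1.symm
  have hre : ∀ t, hpRe (ofHalfPlane (w t)) = (w t).re := fun t => hpRe_ofHalfPlane (hw0 t)
  have him' : ∀ t, hpIm (ofHalfPlane (w t)) = (w t).im := fun t =>
    hpIm_ofHalfPlane (hw0 t) (him t)
  have hc : Continuous fun t => ofHalfPlane (w t) := by
    refine Continuous.prodMk ?_ (Continuous.subtype_mk ?_ _)
    · exact hw.norm.log fun t => norm_ne_zero_iff.2 (hw0 t)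
    · exact (Complex.continuous_re.comp hw).div hw.norm fun t => norm_ne_zero_iff.2 (hw0 t)
  refine ⟨⟨_, hc⟩, ?_, ?_, ?_, ?_, ?_⟩
  · exact hp_injective ((hre 0).trans re0) ((him' 0).trans (im0.trans hp.symm))
  · exact hp_injective ((hre 1).trans re1) ((him' 1).trans (im1.trans hq.symm))
  · intro s t hst
    have h1 : hpRe (ofHalfPlane (w s)) = hpRe (ofHalfPlane (w t)) := congrArg hpRe hst
    rw [hre, hre] at h1
    exact Subtype.ext (mul_right_cancel₀ hne (add_left_cancel h1))
  · intro t ht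
    exact hend t ((him' t).symm.trans ht)
  · intro t
    have h1 : (hpRe (ofHalfPlane (w t)) - hpRe p) * (hpRe q - hpRe (ofHalfPlane (w t))) =
        hpIm (ofHalfPlane (w t)) ^ 2 := by
      rw [hre, him', mul_pow, sq_abs, Real.sq_sqrt (hnn t)]
      ring
    exact h1

end Mobius

/-! ### Simple arcs as non-crossing pairs of lifted vertices -/

namespace Mobius

open unitInterval

namespace Marking

variable {n : ℕ} (P : Marking n)

/-- A point of the universal cover lying over a vertex. -/
def OverVertex (p : Cover) : Prop := proj p ∈ P.vertices

variable {P}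

lemma OverVertex.onBoundary {p : Cover} (h : P.OverVertex p) : OnBoundary p := by
  obtain ⟨k, hk⟩ := h
  exact proj_mem_boundary_iff.1 ⟨_, hk⟩

lemma OverVertex.deck {p : Cover} (h : P.OverVertex p) (k : ℤ) : P.OverVertex (deck k p) := by
  unfold OverVertex
  rwa [proj_deck]

lemma vertices_subset_boundary : P.vertices ⊆ boundary := by
  rintro _ ⟨k, rfl⟩
  exact ⟨_, rfl⟩

lemma IsSimpleArc.eq_zero_or_one {a : Curve} (ha : P.IsSimpleArc a) {t : I}
    (ht : a t ∈ boundary) : t = 0 ∨ t = 1 := by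
  by_contra! h
  exact ha.interior t h.1 h.2 ht

lemma IsSimpleArc.reverse {a : Curve} (ha : P.IsSimpleArc a) :
    P.IsSimpleArc (Curve.reverse a) where
  source := by simpa [Curve.reverse] using ha.target
  target := by simpa [Curve.reverse] using ha.source
  interior := fun t h0 h1 => ha.interior (σ t) (fun h => h1 (symm_eq_zero.1 h))
    (fun h => h0 (symm_eq_one.1 h))
  simple := fun s t h => by
    rcases ha.simple (σ s) (σ t) h with h | ⟨h, h'⟩ | ⟨h, h'⟩
    · exact Or.inl (symm_inj.1 h)
    · exact Or.inr (Or.inr ⟨symm_eq_zero.1 h, symm_eq_one.1 h'⟩)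
    · exact Or.inr (Or.inl ⟨symm_eq_one.1 h, symm_eq_zero.1 h'⟩)

/-- Lifts of two disjoint simple arcs do not cross. -/
lemma not_cross_of_disjoint {a b : Curve} (ha : P.IsSimpleArc a) (hb : P.IsSimpleArc b)
    (hab : ∀ s t : I, a s = b t → a s ∈ P.vertices) {p q r s : Cover} (hpq : Joins a p q)
    (hrs : Joins b r s) : ¬ Cross p q r s := by
  intro h
  have hp := hpq.source ▸ ha.source
  have hq := hpq.target ▸ ha.target
  have hr := hrs.source ▸ hb.source
  have hs := hrs.target ▸ hb.target
  obtain ⟨γ, h1, rfl, rfl⟩ := hpq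
  obtain ⟨δ, k1, rfl, rfl⟩ := hrs
  obtain ⟨u, v, huv⟩ := Cross.exists_eq γ δ (OverVertex.onBoundary hp) (OverVertex.onBoundary hq)
    (OverVertex.onBoundary hr) (OverVertex.onBoundary hs) h
  have e : a u = b v := by rw [← h1, ← k1, huv]
  have hu := hab u v e
  obtain ⟨n1, n2, n3, n4⟩ := h.ne
  rcases ha.eq_zero_or_one (vertices_subset_boundary hu) with rfl | rfl <;>
    rcases hb.eq_zero_or_one (vertices_subset_boundary (e ▸ hu)) with rfl | rfl <;>
    contradiction

/-- A lift of a simple arc does not cross its translates. -/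
lemma IsSimpleArc.not_cross_deck {a : Curve} (ha : P.IsSimpleArc a) {p q : Cover}
    (hpq : Joins a p q) (k : ℤ) : ¬ Cross p q (Mobius.deck k p) (Mobius.deck k q) := by
  intro h
  have hp : P.OverVertex p :=
    show proj p ∈ _ from hpq.source ▸ ha.source
  have hq : P.OverVertex q :=
    show proj q ∈ _ from hpq.target ▸ ha.target
  obtain ⟨γ, h1, h2, h3⟩ := hpq
  let δ : C(I, Cover) := ⟨fun t => Mobius.deck k (γ t), (continuous_deck k).comp γ.continuous⟩
  have hδ : ∀ t, δ t = Mobius.deck k (γ t) := fun _ => rfl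
  obtain ⟨u, v, huv⟩ := Cross.exists_eq γ δ (by rw [h2]; exact hp.onBoundary)
    (by rw [h3]; exact hq.onBoundary) (by rw [hδ, h2]; exact (hp.deck k).onBoundary)
    (by rw [hδ, h3]; exact (hq.deck k).onBoundary) (by rwa [hδ, hδ, h2, h3])
  rw [hδ] at huv
  obtain ⟨n1, n2, n3, n4⟩ := h.ne
  -- A common point of the lift and its translate projects to a coincidence on `a`. Equal parameters
  -- force `k = 0` since the deck action is free; opposite ends would give the two pairs a common
  -- endpoint. Both contradict `Cross.ne`.
  rcases ha.simple u v (by rw [← h1, ← h1, huv, proj_deck]) with rfl | ⟨rfl, rfl⟩ | ⟨rfl, rfl⟩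
  · have : k = 0 := deck_injective (huv.symm.trans (deck_zero _).symm)
    subst this
    exact n1 (deck_zero p).symm
  · rw [h2, h3] at huv
    exact n2 huv
  · rw [h2, h3] at huv
    exact n3 huv

lemma IsSimpleArc.exists_joins {a : Curve} (ha : P.IsSimpleArc a) {p q : Cover}
    (h : classOf a = arcClass p q) :
    ∃ a', P.IsSimpleArc a' ∧ Joins a' p q ∧ ∀ t, ∃ s, a' t = a s := by
  rcases Joins.of_classOf_eq h with h | h
  · exact ⟨a, ha, h, fun t => ⟨t, rfl⟩⟩
  · exact ⟨_, ha.reverse, h.reverse, fun t => ⟨σ t, rfl⟩⟩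

lemma DisjointClasses.not_cross {p q r s : Cover}
    (h : P.DisjointClasses (arcClass p q) (arcClass r s)) (k : ℤ) :
    ¬ Cross p q (Mobius.deck k r) (Mobius.deck k s) := by
  obtain ⟨a, b, ha, hb, ea, eb, hab⟩ := h
  obtain ⟨a', ha', hpq, h1⟩ := ha.exists_joins ea
  obtain ⟨b', hb', hrs, h2⟩ := hb.exists_joins eb
  refine not_cross_of_disjoint ha' hb' (fun s t hst => ?_) hpq (hrs.deck k)
  obtain ⟨u, hu⟩ := h1 s
  obtain ⟨v, hv⟩ := h2 t
  rw [hu]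
  exact hab u v (by rw [← hu, ← hv, hst])

lemma DisjointClasses.symm {c d : CurveClass} (h : P.DisjointClasses c d) :
    P.DisjointClasses d c := by
  obtain ⟨a, b, ha, hb, ea, eb, hab⟩ := h
  exact ⟨b, a, hb, ha, eb, ea, fun s t hst => hst ▸ hab t s hst.symm⟩

/-- A pair of distinct points over vertices whose translates do not separate each other. -/
structure IsSimplePair (P : Marking n) (p q : Cover) : Prop where
  left : P.OverVertex p
  right : P.OverVertex q
  ne : p ≠ q
  not_cross : ∀ k, ¬ Cross p q (Mobius.deck k p) (Mobius.deck k q)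

/-- The projection of a half circle joining a simple pair is a simple arc. -/
lemma IsSimplePair.exists_isSimpleArc {p q : Cover} (h : P.IsSimplePair p q) :
    ∃ γ : C(I, Cover), P.IsSimpleArc ⟨fun t => proj (γ t), continuous_proj.comp γ.continuous⟩ ∧
      γ 0 = p ∧ γ 1 = q ∧ ∀ t, OnGeodesic p q (γ t) := by
  have bp := h.left.onBoundary
  have bq := h.right.onBoundary
  obtain ⟨γ, h0, h1, hinj, hend, hgeo⟩ := exists_geodesic bp bq h.ne
  refine ⟨γ, ⟨?_, ?_, ?_, ?_⟩, h0, h1, hgeo⟩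
  · change proj (γ 0) ∈ _
    rw [h0]
    exact h.left
  · change proj (γ 1) ∈ _
    rw [h1]
    exact h.right
  · intro t t0 t1 ht
    rcases hend t (proj_mem_boundary_iff.1 ht) with h | h
    · exact t0 h
    · exact t1 h
  · intro s t hst
    obtain ⟨k, hk⟩ := proj_eq_proj_iff.1 (show proj (γ s) = proj (γ t) from hst)
    by_cases hs : OnBoundary (γ s)
    · have ht : OnBoundary (γ t) := hk ▸ hs.deck k
      rcases hend s hs with rfl | rfl <;> rcases hend t ht with rfl | rfl <;> simp
    · have ht : ¬ OnBoundary (γ t) := fun ht => hs (by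
        have := ht.deck (-k)
        rwa [hk, deck_neg_deck] at this)
      have hk0 : k = 0 := by
        rcases (hgeo t).eq_or_eq bp bq (bp.deck k) (bq.deck k) (hk ▸ (hgeo s).deck k) ht
          (h.not_cross k) with ⟨e1, -⟩ | ⟨e1, e2⟩
        · exact deck_injective (e1.trans (deck_zero p).symm)
        -- If the transformation swaps the two ends, its square fixes `p`, so again `k = 0`.
        · rw [← e1, ← deck_add] at e2
          have := deck_injective (e2.trans (deck_zero p).symm)
          lia
      rw [hk0, deck_zero] at hk
      exact Or.inl (hinj hk.symm)

lemma IsSimplePair.exists_classOf {p q : Cover} (h : P.IsSimplePair p q) :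
    ∃ a, P.IsSimpleArc a ∧ classOf a = arcClass p q := by
  obtain ⟨γ, h1, h2, h3, -⟩ := h.exists_isSimpleArc
  exact ⟨_, h1, Joins.classOf_eq ⟨γ, fun _ => rfl, h2, h3⟩⟩

/-- Half circles are simultaneous optimal representatives: a meeting off the boundary would make two
of them coincide, hence the classes would be equal. -/
lemma IsSimplePair.disjointClasses {p q r s : Cover} (h : P.IsSimplePair p q)
    (h' : P.IsSimplePair r s) (hne : arcClass p q ≠ arcClass r s)
    (hc : ∀ k, ¬ Cross p q (Mobius.deck k r) (Mobius.deck k s)) :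
    P.DisjointClasses (arcClass p q) (arcClass r s) := by
  obtain ⟨γ, h1, h2, h3, h4⟩ := h.exists_isSimpleArc
  obtain ⟨δ, k1, k2, k3, k4⟩ := h'.exists_isSimpleArc
  refine ⟨_, _, h1, k1, Joins.classOf_eq ⟨γ, fun _ => rfl, h2, h3⟩,
    Joins.classOf_eq ⟨δ, fun _ => rfl, k2, k3⟩, fun u v huv => ?_⟩
  obtain ⟨k, hk⟩ := proj_eq_proj_iff.1 (show proj (δ v) = proj (γ u) from huv.symm)
  by_cases hb : OnBoundary (γ u)
  · rcases h1.eq_zero_or_one (t := u) (proj_mem_boundary_iff.2 hb) with rfl | rfl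
    · exact h1.source
    · exact h1.target
  · refine absurd (arcClass_eq_arcClass_iff.2 ⟨-k, ?_⟩) hne
    have e : ∀ x y, Mobius.deck k x = y → x = Mobius.deck (-k) y := by
      rintro x _ rfl
      rw [deck_neg_deck]
    rcases (h4 u).eq_or_eq h.left.onBoundary h.right.onBoundary (h'.left.onBoundary.deck k)
      (h'.right.onBoundary.deck k) (hk ▸ (k4 v).deck k) hb (hc k) with ⟨e1, e2⟩ | ⟨e1, e2⟩
    · exact Or.inl ⟨e _ _ e1, e _ _ e2⟩
    · exact Or.inr ⟨e _ _ e1, e _ _ e2⟩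

/-- A simple arc is trivial or comes from a simple pair. -/
lemma IsArcClass.exists_isSimplePair {c : CurveClass} (h : P.IsArcClass c) :
    ∃ k q, P.IsSimplePair (P.pos k, ⟨1, by norm_num⟩) q ∧
      c = arcClass (P.pos k, ⟨1, by norm_num⟩) q := by
  obtain ⟨hc, a, ha, rfl⟩ := h
  obtain ⟨k, hk⟩ := ha.source
  have hp : a 0 = proj (P.pos k, ⟨1, by norm_num⟩) := hk.symm
  obtain ⟨q, hq⟩ := Mobius.exists_joins hp
  refine ⟨k, q, ⟨⟨k, rfl⟩, show proj q ∈ _ from hq.target ▸ ha.target, ?_,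
    ha.not_cross_deck hq⟩, hq.classOf_eq⟩
  rintro rfl
  refine hc ⟨k, Or.inl ?_⟩
  rw [hq.classOf_eq]
  exact (Joins.classOf_eq ⟨.const I _, fun _ => rfl, rfl, rfl⟩).symm

end Marking

end Mobius

/-! ### Combinatorial arcs and the short arcs that obstruct domination -/

namespace Mobius

/-- Combinatorial arcs: `b i j` joins the lifts of `i` and `j` on the upper boundary line of the
universal cover, `c i j` joins the lift of `i` on the upper line to the lift of `j` on the lower
line. -/
inductive Arc where
  | b (i j : ℤ) : Arc
  | c (i j : ℤ) : Arc

namespace Arc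

/-- The combinatorial arcs that are realised by non-trivial simple arcs. -/
def Valid (n : ℕ) : Arc → Prop
  -- The lower bound excludes vertices and boundary edges, the upper one a crossing with the
  -- translate by `n`. For `c i j`, the bounds exclude a crossing with its flipped translate `c (j +
  -- n) i`.
  | b i j => i + 2 ≤ j ∧ j ≤ i + n
  | c i j => j ≤ i ∧ i ≤ j + n

/-- A translate of the second arc crosses the first one. -/
def Crosses (n : ℕ) : Arc → Arc → Prop
  | b i j, b k l => ∃ m : ℤ, (i < k + m * n ∧ k + m * n < j ∧ j < l + m * n) ∨
      (k + m * n < i ∧ i < l + m * n ∧ l + m * n < j)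
  | b i j, c k l => ∃ m : ℤ, (i < k + m * n ∧ k + m * n < j) ∨ (i < l + m * n ∧ l + m * n < j)
  | c k l, b i j => ∃ m : ℤ, (i < k + m * n ∧ k + m * n < j) ∨ (i < l + m * n ∧ l + m * n < j)
  -- The last two alternatives concern odd deck transformations, which swap the boundary lines and
  -- turn `c k l` into translates of `c (l + n) k`.
  | c i j, c k l => ∃ m : ℤ, (i < k + m * n ∧ l + m * n < j) ∨ (k + m * n < i ∧ j < l + m * n) ∨
      (i < l + m * n + n ∧ k + m * n < j) ∨ (l + m * n + n < i ∧ j < k + m * n)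

/-- The arcs crossing the core of the strip, and those cutting off a triangle. -/
def Short : Arc → Prop
  | b i j => j = i + 2
  | c _ _ => True

variable {n : ℕ}

/-- Lets linear arithmetic treat `m * n` as an atom: a nontrivial translate moves by at least a full
period. -/
lemma mul_trichotomy (m : ℤ) (n : ℕ) : m * n = 0 ∨ (n : ℤ) ≤ m * n ∨ m * n ≤ -n := by
  rcases lt_trichotomy m 0 with h | rfl | h
  · right; right
    nlinarith
  · left; simp
  · right; left
    nlinarith

/-- Every integer has a translate in a given period. -/
lemma exists_translate (hn : 0 < n) (i k : ℤ) : ∃ m : ℤ, i ≤ k + m * n ∧ k + m * n < i + n := by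
  refine ⟨-((k - i) / n), ?_⟩
  have h1 := Int.emod_add_mul_ediv (k - i) n
  have h2 := Int.emod_nonneg (k - i) (show (n : ℤ) ≠ 0 by lia)
  have h3 := Int.emod_lt_of_pos (k - i) (show (0 : ℤ) < n by lia)
  have h4 : -((k - i) / n) * (n : ℤ) = -(n * ((k - i) / n)) := by ring
  constructor <;> lia

/-- Translate so that `x - n < l' < x`. If `x < k'`, the translate `c k' l'` itself crosses `c x x`;
otherwise its flip `c (l' + n) k'` does. -/
lemma crosses_loop_c (hn : 0 < n) {k l x : ℤ} (_ : l ≤ k ∧ k ≤ l + n)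
    (hk : ∀ m : ℤ, x ≠ k + m * n) (hl : ∀ m : ℤ, x ≠ l + m * n) :
    Crosses n (c x x) (c k l) := by
  obtain ⟨m, h1, h2⟩ := exists_translate hn (x - n) l
  have h3 := hl m
  have h4 := hl (m + 1)
  have h5 := hk m
  have e : (m + 1) * (n : ℤ) = m * n + n := by ring
  rw [e] at h4
  by_cases h : x < k + m * n
  · exact ⟨m, by lia⟩
  · refine ⟨m, by lia⟩

lemma not_crosses_b_loop {i j x : ℤ} (h : j ≤ i + n) (hx : x + n = j ∨ x = i ∨ j ≤ x ∧ x ≤ i + n) :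
    ¬ Crosses n (b i j) (c x x) := by
  rintro ⟨m, hm⟩
  rcases mul_trichotomy m n with h1 | h1 | h1 <;> lia

/-- An arc disjoint from a `b`-arc and different from it is crossed by a short arc that is disjoint
from the `b`-arc. -/
lemma exists_short_crosses_b_b (hn : 4 ≤ n) {i j k l : ℤ} (hv : Valid n (b i j))
    (hw : Valid n (b k l)) (hc : ¬ Crosses n (b i j) (b k l))
    (hne : ∀ m : ℤ, ¬ (i = k + m * n ∧ j = l + m * n)) :
    ∃ w, Valid n w ∧ Short w ∧ ¬ Crosses n (b i j) w ∧ Crosses n w (b k l) := by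
  obtain ⟨m, h1, h2⟩ := exists_translate (show 0 < n by lia) i k
  have hne0 := hne m
  have hne1 := hne (m - 1)
  simp only [Valid] at hv hw
  have c0 := fun h => hc ⟨m, h⟩
  have c1 := fun h => hc ⟨m - 1, h⟩
  have e1 : (m - 1) * (n : ℤ) = m * n - n := by ring
  have e2 : -m * (n : ℤ) = -(m * n) := by ring
  have e3 : -(m - 1) * (n : ℤ) = -(m * n) + n := by ring
  rw [e1] at c1 hne1
  -- An arc inside the polygon of `b i j` is crossed by the triangle at an end it does not share
  -- with `b i j`. Otherwise a loop `c x x`, based at `i`, at `j` or outside the polygon, crosses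
  -- it.
  by_cases hkj : k + m * n < j
  · by_cases hlj : l + m * n ≤ j
    · by_cases hki : i < k + m * n
      · refine ⟨b (k + m * n - 1) (k + m * n + 1), ⟨by lia, by lia⟩, by simp only [Short]; lia,
          ?_, ⟨m, by lia⟩⟩
        rintro ⟨t, ht⟩
        rcases mul_trichotomy t n with h | h | h <;> lia
      · refine ⟨b (l + m * n - 1) (l + m * n + 1), ⟨by lia, by lia⟩, by simp only [Short]; lia,
          ?_, ⟨m, by lia⟩⟩
        rintro ⟨t, ht⟩
        rcases mul_trichotomy t n with h | h | h <;> lia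
    · exact ⟨c j j, ⟨by lia, by lia⟩, trivial, not_crosses_b_loop hv.2 (by lia), -m, by lia⟩
  · by_cases hl : l + m * n ≤ i + n
    · exact ⟨c (k + m * n + 1) (k + m * n + 1), ⟨by lia, by lia⟩, trivial,
        not_crosses_b_loop hv.2 (by lia), -m, by lia⟩
    · by_cases hki : k + m * n - n < i
      · exact ⟨c i i, ⟨by lia, by lia⟩, trivial, not_crosses_b_loop hv.2 (by lia), -(m - 1),
          by lia⟩
      · exact ⟨c j j, ⟨by lia, by lia⟩, trivial, not_crosses_b_loop hv.2 (by lia), -(m - 1),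
          by lia⟩

/-- Two residue classes miss one of three consecutive vertices outside a `b`-arc. -/
lemma exists_loop_crosses_c (hn : 0 < n) {k l x y z : ℤ} (hv : Valid n (c k l)) (hxy : x < y)
    (hyz : y < z) (hz : z < x + n) : ∃ u, (u = x ∨ u = y ∨ u = z) ∧ Crosses n (c u u) (c k l) := by
  by_contra! hcon
  have key : ∀ u, (u = x ∨ u = y ∨ u = z) →
      (∃ m : ℤ, u = k + m * n) ∨ ∃ m : ℤ, u = l + m * n := by
    intro u hu
    by_contra! h
    exact hcon u hu (crosses_loop_c hn hv h.1 h.2)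
  have inj : ∀ t u v m m' : ℤ, u < v → v < u + n → u = t + m * (n : ℤ) → v = t + m' * n →
      False := by
    intro t u v m m' h1 h2 h3 h4
    have := mul_trichotomy (m' - m) n
    rw [sub_mul] at this
    lia
  rcases key x (by simp) with ⟨m1, h1⟩ | ⟨m1, h1⟩ <;>
    rcases key y (by simp) with ⟨m2, h2⟩ | ⟨m2, h2⟩ <;>
    rcases key z (by simp) with ⟨m3, h3⟩ | ⟨m3, h3⟩
  · exact inj _ _ _ _ _ hxy (by lia) h1 h2
  · exact inj _ _ _ _ _ hxy (by lia) h1 h2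
  · exact inj _ _ _ _ _ (hxy.trans hyz) hz h1 h3
  · exact inj _ _ _ _ _ hyz (by lia) h2 h3
  · exact inj _ _ _ _ _ hyz (by lia) h2 h3
  · exact inj _ _ _ _ _ (hxy.trans hyz) hz h1 h3
  · exact inj _ _ _ _ _ hxy (by lia) h1 h2
  · exact inj _ _ _ _ _ hxy (by lia) h1 h2

/-- The bound on `j` leaves three vertices `j`, `j + 1`, `i + n` not strictly inside the polygon,
and `c k l` has only two ends. Maximal and adjacent arcs leave only one or two such vertices. -/
lemma exists_short_crosses_b_c (hn : 4 ≤ n) {i j k l : ℤ} (hv : Valid n (b i j))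
    (hj : j ≤ i + n - 2) (hw : Valid n (c k l)) :
    ∃ w, Valid n w ∧ Short w ∧ ¬ Crosses n (b i j) w ∧ Crosses n w (c k l) := by
  obtain ⟨u, hu, h⟩ := exists_loop_crosses_c (show 0 < n by lia) hw (x := j) (y := j + 1)
    (z := i + n) (by lia) (by lia) (by simp only [Valid] at hv; lia)
  exact ⟨c u u, ⟨by lia, by lia⟩, trivial, not_crosses_b_loop hv.2 (by lia), h⟩

/-- Outside an adjacent arc, a `c`-arc is crossed by one of the two maximal arcs or by the core
curve based at the other vertex. -/
lemma exists_crosses_adjacent_c (hn : 4 ≤ n) {i k l : ℤ} (hw : Valid n (c k l)) {x y : ℤ}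
    (hxy : (x = i ∧ y = i + 1) ∨ (x = i + 1 ∧ y = i)) :
    ∃ w, Valid n w ∧ (w = b x (x + n) ∨ Short w) ∧ ¬ Crosses n (b (i + 1) (i + n)) w ∧
      Crosses n w (c k l) := by
  by_cases h : Crosses n (b x (x + n)) (c k l)
  · refine ⟨b x (x + n), ⟨by lia, by lia⟩, Or.inl rfl, ?_, h⟩
    rintro ⟨t, ht⟩
    rcases mul_trichotomy t n with h | h | h <;> lia
  -- If `M_x` does not cross `c k l`, both ends of `c k l` are congruent to `x`, so the other vertex
  -- `y` is an end of neither kind.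
  · have key : ∀ t, (∀ m : ℤ, ¬ (x < t + m * n ∧ t + m * n < x + n)) → ∀ m : ℤ, y ≠ t + m * n := by
      rintro t ht m rfl
      have h1 := ht m
      have h2 := ht (m + 1)
      rw [add_mul, one_mul] at h2
      lia
    refine ⟨c y y, ⟨by lia, by lia⟩, Or.inr trivial,
      not_crosses_b_loop (by lia) (by lia), crosses_loop_c (by lia) hw (key k fun m hm => ?_)
        (key l fun m hm => ?_)⟩
    · exact h ⟨m, Or.inl hm⟩
    · exact h ⟨m, Or.inr hm⟩

/-- The arcs of the polygon obtained by cutting along `c i j`. -/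
lemma not_crosses_c_c {i j k l : ℤ} (hv : Valid n (c i j)) (h1 : i ≤ k) (h2 : k ≤ j + n)
    (h3 : j ≤ l) (h4 : l ≤ i) : ¬ Crosses n (c i j) (c k l) := by
  simp only [Valid] at hv
  rintro ⟨m, hm⟩
  rcases mul_trichotomy m n with h | h | h
  · lia
  · lia
  · rcases mul_trichotomy (m + 1) n with h' | h' | h' <;> rw [add_mul, one_mul] at h' <;> lia

/-- Cutting along `c i j` gives a polygon with upper vertices `i, …, j + n` and lower vertices `j,
…, i`. The arc `b k l` cuts off part of one side, so a diagonal from the vertex after its start to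
an opposite corner crosses it. -/
lemma exists_short_crosses_c_b (hn : 4 ≤ n) {i j k l : ℤ} (hv : Valid n (c i j))
    (hw : Valid n (b k l)) (hc : ¬ Crosses n (c i j) (b k l)) :
    ∃ w, Valid n w ∧ Short w ∧ ¬ Crosses n (c i j) w ∧ Crosses n w (b k l) := by
  obtain ⟨m, h1, h2⟩ := exists_translate (show 0 < n by lia) i k
  have e1 : (m - 1) * (n : ℤ) = m * n - n := by ring
  have c0 : ∀ t : ℤ, ¬ (k < i + t * n ∧ i + t * n < l ∨ k < j + t * n ∧ j + t * n < l) :=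
    fun t h => hc ⟨t, h⟩
  have d0 := c0 (-m)
  have d1 := c0 (1 - m)
  have d2 := c0 (2 - m)
  simp only [sub_mul, neg_mul, one_mul] at d0 d1 d2
  have hv' := hv
  simp only [Valid] at hv hw
  by_cases h : k + m * n < j + n
  · exact ⟨c (k + m * n + 1) j, ⟨by lia, by lia⟩, trivial,
      not_crosses_c_c hv' (by lia) (by lia) (by lia) (by lia), -m, by lia⟩
  · exact ⟨c i (k + m * n + 1 - n), ⟨by lia, by lia⟩, trivial,
      not_crosses_c_c hv' (by lia) (by lia) (by lia) (by lia), 1 - m, by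
        rw [sub_mul, one_mul]
        lia⟩

/-- A `c`-arc disjoint from `c i j` is a diagonal of the polygon obtained by cutting along it. -/
lemma exists_diagonal (hn : 0 < n) {i j k l : ℤ} (hv : Valid n (c i j)) (hw : Valid n (c k l))
    (hc : ¬ Crosses n (c i j) (c k l)) : ∃ m k' l' : ℤ, i ≤ k' ∧ k' ≤ j + n ∧ j ≤ l' ∧ l' ≤ i ∧
      ((k' = k + m * n ∧ l' = l + m * n) ∨ (k' = l + m * n + n ∧ l' = k + m * n)) := by
  obtain ⟨m, h1, h2⟩ := exists_translate hn i k
  have c0 := fun h => hc ⟨m, h⟩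
  have c1 := fun h => hc ⟨m - 1, h⟩
  simp only [sub_mul, one_mul] at c1
  simp only [Valid] at hv hw
  by_cases ha : k + m * n ≤ j + n ∧ j ≤ l + m * n ∧ l + m * n ≤ i
  · exact ⟨m, _, _, h1, ha.1, ha.2.1, ha.2.2, Or.inl ⟨rfl, rfl⟩⟩
  by_cases hb : j ≤ k + m * n - n ∧ k + m * n - n ≤ i ∧ i ≤ l + m * n ∧ l + m * n ≤ j + n
  · refine ⟨m - 1, l + m * n, k + m * n - n, hb.2.2.1, hb.2.2.2, hb.1, hb.2.1, Or.inr ?_⟩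
    rw [sub_mul, one_mul]
    lia
  · refine ⟨m, l + m * n + n, k + m * n, ?_, ?_, ?_, ?_, Or.inr ⟨rfl, rfl⟩⟩ <;> lia

lemma exists_short_crosses_c_c (hn : 4 ≤ n) {i j k l : ℤ} (hv : Valid n (c i j))
    (hw : Valid n (c k l)) (hc : ¬ Crosses n (c i j) (c k l))
    (hne : ∀ m : ℤ, ¬ (i = k + m * n ∧ j = l + m * n))
    (hne' : ∀ m : ℤ, ¬ (i = l + m * n + n ∧ j = k + m * n)) :
    ∃ w, Valid n w ∧ Short w ∧ ¬ Crosses n (c i j) w ∧ Crosses n w (c k l) := by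
  obtain ⟨m, k', l', h1, h2, h3, h4, h⟩ := exists_diagonal (by lia) hv hw hc
  have hcc : ∀ p q, (p < k' ∧ l' < q) ∨ (k' < p ∧ q < l') → Crosses n (c p q) (c k l) :=
    fun p q hpq => ⟨m, by lia⟩
  have h5 : ¬ (i = k' ∧ j = l') := by
    have := hne m
    have := hne' m
    lia
  have h6 : ¬ (i = l' ∧ j + n = k') := by
    have := hne' (m - 1)
    have := hne m
    rw [sub_mul, one_mul] at *
    lia
  have hv' := hv
  simp only [Valid] at hv
  have key : ∀ p q, i ≤ p → p ≤ j + n → j ≤ q → q ≤ i → (p < k' ∧ l' < q) ∨ (k' < p ∧ q < l') →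
      ∃ w, Valid n w ∧ Short w ∧ ¬ Crosses n (c i j) w ∧ Crosses n w (c k l) :=
    fun p q a1 a2 a3 a4 hpq => ⟨c p q, ⟨by lia, by lia⟩, trivial,
      not_crosses_c_c hv' a1 a2 a3 a4, hcc p q hpq⟩
  -- Shifting both ends of the diagonal by one, in opposite index directions, gives a crossing
  -- diagonal. Both shifts fail only if one side of the polygon is a single vertex and the diagonal
  -- starts there; the triangle at its other end then crosses it.
  by_cases ha : i < k' ∧ l' < i
  · exact key (k' - 1) (l' + 1) (by lia) (by lia) (by lia) (by lia) (by lia)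
  by_cases hb : k' < j + n ∧ j < l'
  · exact key (k' + 1) (l' - 1) (by lia) (by lia) (by lia) (by lia) (by lia)
  by_cases hd : i = j + n
  · refine ⟨b (l' - 1) (l' + 1), ⟨by lia, by lia⟩, by simp only [Short]; lia, ?_, ?_⟩
    · rintro ⟨t, ht⟩
      rcases mul_trichotomy t n with h | h | h <;> lia
    · rcases h with ⟨-, h⟩ | ⟨-, h⟩
      · exact ⟨m, by lia⟩
      · exact ⟨m, by lia⟩
  · refine ⟨b (k' - 1) (k' + 1), ⟨by lia, by lia⟩, by simp only [Short]; lia, ?_, ?_⟩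
    · rintro ⟨t, ht⟩
      rcases mul_trichotomy t n with h | h | h <;> lia
    · rcases h with ⟨h, -⟩ | ⟨h, -⟩
      · exact ⟨m, by lia⟩
      · refine ⟨m + 1, ?_⟩
        rw [add_mul, one_mul]
        lia

lemma not_crosses_self : ∀ {a : Arc}, Valid n a → ¬ Crosses n a a
  | b i j, hv => by
    simp only [Valid] at hv
    rintro ⟨m, hm⟩
    rcases mul_trichotomy m n with h | h | h <;> lia
  | c i j, hv => not_crosses_c_c hv le_rfl hv.2 le_rfl hv.1

/-- An arc disjoint from a maximal arc is disjoint from the core curve at its base point. -/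
lemma not_crosses_loop_of_not_crosses_maximal {x : ℤ} : ∀ {w : Arc}, Valid n w →
    ¬ Crosses n (b x (x + n)) w → ¬ Crosses n (c x x) w
  | b k l, hv, hw => by
    rintro ⟨m, hm⟩
    simp only [Valid] at hv
    have h1 := fun h => hw ⟨-m, h⟩
    have h2 := fun h => hw ⟨1 - m, h⟩
    rw [neg_mul] at h1
    rw [sub_mul, one_mul] at h2
    lia
  | c k l, hv, hw => by
    rintro ⟨m, hm⟩
    simp only [Valid] at hv
    have h1 := fun h => hw ⟨m, h⟩
    have h2 := fun h => hw ⟨m + 1, h⟩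
    rw [add_mul, one_mul] at h2
    lia

/-- An arc disjoint from an adjacent arc and different from the two maximal arcs is disjoint from
the `c`-arc joining the two vertices. -/
lemma not_crosses_c_of_not_crosses_adjacent {i : ℤ} : ∀ {w : Arc}, Valid n w →
    ¬ Crosses n (b (i + 1) (i + n)) w → (∀ x, (x = i ∨ x = i + 1) → ∀ m : ℤ,
      w ≠ b (x + m * n) (x + m * n + n)) → ¬ Crosses n (c (i + 1) i) w
  | b k l, hv, hw, hne => by
    rintro ⟨m, hm⟩
    simp only [Valid] at hv
    have h1 := fun h => hw ⟨-m, h⟩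
    have h2 := fun h => hw ⟨1 - m, h⟩
    rw [neg_mul] at h1
    rw [sub_mul, one_mul] at h2
    have h3 := hne i (Or.inl rfl) m
    have h4 := hne (i + 1) (Or.inr rfl) (m - 1)
    simp only [ne_eq, b.injEq, sub_mul, one_mul] at h3 h4
    rcases hm with hm | hm <;> lia
  | c k l, hv, hw, _ => by
    rintro ⟨m, hm⟩
    simp only [Valid] at hv
    have h1 := fun h => hw ⟨m, h⟩
    have h2 := fun h => hw ⟨m + 1, h⟩
    rw [add_mul, one_mul] at h2
    rcases hm with hm | hm | hm | hm <;> lia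

end Arc

end Mobius

/-! ### Dictionary between homotopy classes and combinatorial arcs -/

namespace Mobius

open unitInterval

lemma interlaced_iff {a b c d : ℝ} (hab : a < b) : Interlaced a b c d ↔
    (a < c ∧ c < b ∧ (d < a ∨ b < d)) ∨ (a < d ∧ d < b ∧ (c < a ∨ b < c)) := by
  have neg : ∀ x, (x - a) * (x - b) < 0 ↔ a < x ∧ x < b := by
    intro x
    rw [mul_neg_iff, sub_pos, sub_neg, sub_neg, sub_pos]
    exact or_iff_left fun h => by linarith
  have pos : ∀ x, 0 < (x - a) * (x - b) ↔ x < a ∨ b < x := by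
    intro x
    rw [mul_pos_iff, sub_pos, sub_pos, sub_neg, sub_neg]
    constructor
    · rintro (h | h)
      · exact Or.inr h.2
      · exact Or.inl h.1
    · rintro (h | h)
      · exact Or.inr ⟨h, h.trans hab⟩
      · exact Or.inl ⟨hab.trans h, h⟩
  unfold Interlaced
  rw [mul_neg_iff, neg, neg, pos, pos]
  tauto

lemma Cross.symm {p q r s : Cover} (h : Cross p q r s) : Cross r s p q := by
  unfold Cross Interlaced at *
  linarith

lemma Cross.deck {p q r s : Cover} (h : Cross p q r s) (k : ℤ) :
    Cross (deck k p) (deck k q) (deck k r) (deck k s) := by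
  unfold Cross Interlaced at *
  simp only [hpRe_deck]
  have h1 : 0 < ((-1 : ℝ) ^ k * Real.exp k) ^ 4 := by
    have : (-1 : ℝ) ^ k * Real.exp k ≠ 0 := by positivity
    positivity
  have := mul_neg_of_pos_of_neg h1 h
  linarith

lemma Cross.symm_deck {p q r s : Cover} {k : ℤ}
    (h : Cross p q (Mobius.deck k r) (Mobius.deck k s)) :
    Cross r s (Mobius.deck (-k) p) (Mobius.deck (-k) q) := by
  have := (h.deck (-k)).symm
  rwa [deck_neg_deck, deck_neg_deck] at this

namespace Marking

variable {n : ℕ} (P : Marking n)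

lemma pos_add_mul (k m : ℤ) : P.pos (k + m * n) = P.pos k + 2 * m := by
  induction m using Int.induction_on with
  | zero => simp
  | succ m ih =>
    rw [add_mul, one_mul, ← add_assoc, P.periodic, ih]
    push_cast
    ring
  | pred m ih =>
    have := P.periodic (k + (-m - 1) * n)
    rw [show k + (-(m : ℤ) - 1) * n + n = k + -m * n by ring, ih] at this
    push_cast at *
    linarith

/-- The lift of the `k`-th vertex on the upper boundary line. -/
def top (k : ℤ) : Cover := (P.pos k, ⟨1, by norm_num⟩)

/-- The lift of the `k`-th vertex on the lower boundary line. -/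
noncomputable def bot (k : ℤ) : Cover := (P.pos k + 1, ⟨-1, by norm_num⟩)

lemma deck_even_top (m k : ℤ) : deck (2 * m) (P.top k) = P.top (k + m * n) :=
  cover_ext (by simp [top, pos_add_mul]) (by simp [top, zpow_mul])

lemma deck_even_bot (m k : ℤ) : deck (2 * m) (P.bot k) = P.bot (k + m * n) :=
  cover_ext (by simp [bot, pos_add_mul]; ring) (by simp [bot, zpow_mul])

lemma deck_odd_top (m k : ℤ) : deck (2 * m + 1) (P.top k) = P.bot (k + m * n) :=
  cover_ext (by simp [top, bot, pos_add_mul]; ring)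
    (by simp [top, bot, zpow_mul, zpow_add₀ (by norm_num : (-1 : ℝ) ≠ 0)])

/-- The extra `n` appears because applying the generator twice advances the parameter by `2`, one
full turn of the boundary circle. -/
lemma deck_odd_bot (m k : ℤ) : deck (2 * m + 1) (P.bot k) = P.top (k + m * n + n) :=
  cover_ext (by simp [top, bot, pos_add_mul, P.periodic]; ring)
    (by simp [top, bot, zpow_mul, zpow_add₀ (by norm_num : (-1 : ℝ) ≠ 0)])

lemma overVertex_top (k : ℤ) : P.OverVertex (P.top k) := ⟨k, rfl⟩

lemma overVertex_bot (k : ℤ) : P.OverVertex (P.bot k) := by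
  have := (P.overVertex_top k).deck (2 * 0 + 1)
  rwa [deck_odd_top, zero_mul, add_zero] at this

variable {P} in
lemma OverVertex.eq_top_or_bot {p : Cover} (h : P.OverVertex p) :
    ∃ k, p = P.top k ∨ p = P.bot k := by
  obtain ⟨l, hl⟩ := h
  obtain ⟨k, rfl⟩ := proj_eq_proj_iff.1 (show proj (P.top l) = proj p from hl)
  obtain ⟨m, rfl | rfl⟩ := Int.even_or_odd' k
  · exact ⟨_, Or.inl (P.deck_even_top m l)⟩
  · exact ⟨_, Or.inr (P.deck_odd_top m l)⟩

lemma top_injective {k l : ℤ} (h : P.top k = P.top l) : k = l :=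
  P.strictMono.injective (congrArg Prod.fst h)

lemma top_ne_bot (k l : ℤ) : P.top k ≠ P.bot l := fun h => by
  have : (1 : ℝ) = -1 := congrArg (fun p : Cover => (p.2 : ℝ)) h
  norm_num at this

lemma hpRe_top_lt_top {k l : ℤ} : hpRe (P.top k) < hpRe (P.top l) ↔ k < l := by
  simp [hpRe, top, P.strictMono.lt_iff_lt]

/-- The lower line goes to the negative half-axis, which reverses the order. -/
lemma hpRe_bot_lt_bot {k l : ℤ} : hpRe (P.bot k) < hpRe (P.bot l) ↔ l < k := by
  simp [hpRe, bot, P.strictMono.lt_iff_lt]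

lemma hpRe_bot_lt_top (k l : ℤ) : hpRe (P.bot k) < hpRe (P.top l) := by
  have h1 := Real.exp_pos (P.pos k + 1)
  have h2 := Real.exp_pos (P.pos l)
  simp only [hpRe, top, bot]
  linarith

lemma cross_top_top_top_top {i j k l : ℤ} (hij : i < j) (hkl : k < l) :
    Cross (P.top i) (P.top j) (P.top k) (P.top l) ↔
      (i < k ∧ k < j ∧ j < l) ∨ (k < i ∧ i < l ∧ l < j) := by
  unfold Cross
  rw [interlaced_iff (P.hpRe_top_lt_top.2 hij)]
  simp only [hpRe_top_lt_top]
  lia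

lemma not_cross_top_top_bot_bot {i j k l : ℤ} (hij : i < j) :
    ¬ Cross (P.top i) (P.top j) (P.bot k) (P.bot l) := by
  unfold Cross
  rw [interlaced_iff (P.hpRe_top_lt_top.2 hij)]
  rintro (⟨h, -⟩ | ⟨h, -⟩) <;> exact (P.hpRe_bot_lt_top _ _).not_gt h

lemma cross_top_top_top_bot {i j k l : ℤ} (hij : i < j) :
    Cross (P.top i) (P.top j) (P.top k) (P.bot l) ↔ i < k ∧ k < j := by
  unfold Cross
  rw [interlaced_iff (P.hpRe_top_lt_top.2 hij)]
  have h1 := P.hpRe_bot_lt_top l i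
  simp only [hpRe_top_lt_top, h1, h1.not_gt, true_or, and_true, false_and, or_false]

lemma cross_top_bot_top_bot {i j k l : ℤ} :
    Cross (P.top i) (P.bot j) (P.top k) (P.bot l) ↔ (i < k ∧ l < j) ∨ (k < i ∧ j < l) := by
  have key : Cross (P.top i) (P.bot j) (P.top k) (P.bot l) ↔
      Cross (P.bot j) (P.top i) (P.top k) (P.bot l) := ⟨Cross.swap_left, Cross.swap_left⟩
  rw [key]
  unfold Cross
  rw [interlaced_iff (P.hpRe_bot_lt_top j i)]
  have h1 := fun a b => P.hpRe_bot_lt_top a b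
  have h2 := fun a b => (P.hpRe_bot_lt_top a b).not_gt
  simp only [hpRe_top_lt_top, hpRe_bot_lt_bot, h1, h2]
  lia

lemma bArc_eq (i j : ℤ) : P.bArc i j = arcClass (P.top i) (P.top j) := by
  refine Joins.classOf_eq ⟨⟨fun t => (P.pos i + (t : ℝ) * (P.pos j - P.pos i), ⟨1, by norm_num⟩),
    by fun_prop⟩, fun t => rfl, ?_, ?_⟩
  · exact cover_ext (by simp [top]) rfl
  · exact cover_ext (by simp [top]) rfl

/-- The starting point of a lift of an arc. -/
def arcStart : Arc → Cover
  | .b i _ => P.top i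
  | .c i _ => P.top i

/-- The final point of a lift of an arc. -/
noncomputable def arcEnd : Arc → Cover
  | .b _ j => P.top j
  | .c _ j => P.bot j

/-- The homotopy class of a combinatorial arc. -/
noncomputable def cls (a : Arc) : CurveClass := arcClass (P.arcStart a) (P.arcEnd a)

lemma overVertex_arcStart : ∀ a, P.OverVertex (P.arcStart a)
  | .b i _ => P.overVertex_top i
  | .c i _ => P.overVertex_top i

lemma overVertex_arcEnd : ∀ a, P.OverVertex (P.arcEnd a)
  | .b _ j => P.overVertex_top j
  | .c _ j => P.overVertex_bot j

lemma exists_int_iff {p : ℤ → Prop} : (∃ k, p k) ↔ ∃ m, p (2 * m) ∨ p (2 * m + 1) := by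
  constructor
  · rintro ⟨k, hk⟩
    obtain ⟨m, rfl | rfl⟩ := Int.even_or_odd' k
    · exact ⟨m, Or.inl hk⟩
    · exact ⟨m, Or.inr hk⟩
  · rintro ⟨m, h | h⟩
    · exact ⟨_, h⟩
    · exact ⟨_, h⟩

lemma exists_cross_b_c {i j k l : ℤ} (hij : i < j) :
    (∃ t, Cross (P.top i) (P.top j) (deck t (P.top k)) (deck t (P.bot l))) ↔
      Arc.Crosses n (.b i j) (.c k l) := by
  rw [exists_int_iff]
  simp only [deck_even_top, deck_even_bot, deck_odd_top, deck_odd_bot, Arc.Crosses]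
  have swap : ∀ x y, Cross (P.top i) (P.top j) (P.bot x) (P.top y) ↔ i < y ∧ y < j :=
    fun x y => ⟨fun h => (P.cross_top_top_top_bot hij).1 h.swap_right,
      fun h => ((P.cross_top_top_top_bot hij).2 h).swap_right⟩
  simp only [swap, P.cross_top_top_top_bot hij]
  constructor
  · rintro ⟨m, h | h⟩
    · exact ⟨m, Or.inl h⟩
    -- The odd translate carries the lower end to the upper vertex `l + m * n + n`, hence the index
    -- `m + 1`.
    · exact ⟨m + 1, Or.inr (by rw [add_mul, one_mul]; lia)⟩
  · rintro ⟨m, h | h⟩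
    · exact ⟨m, Or.inl h⟩
    · exact ⟨m - 1, Or.inr (by rw [sub_mul, one_mul]; lia)⟩

/-- Crossing of lifts in terms of the indices of the endpoints. -/
lemma exists_cross_iff : ∀ {a a' : Arc}, a.Valid n → a'.Valid n →
    ((∃ t, Cross (P.arcStart a) (P.arcEnd a) (deck t (P.arcStart a')) (deck t (P.arcEnd a'))) ↔
      a.Crosses n a')
  | .b i j, .b k l, ha, ha' => by
    have hij : i < j := by have := ha.1; lia
    have hkl : k < l := by have := ha'.1; lia
    rw [exists_int_iff]
    simp only [arcStart, arcEnd, deck_even_top, deck_odd_top, P.not_cross_top_top_bot_bot hij,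
      or_false, Arc.Crosses]
    exact exists_congr fun m => P.cross_top_top_top_top hij (by lia)
  | .b i j, .c k l, ha, _ => P.exists_cross_b_c (by have := ha.1; lia)
  | .c k l, .b i j, _, ha => by
    refine Iff.trans ⟨?_, ?_⟩ (P.exists_cross_b_c (i := i) (j := j) (by have := ha.1; lia))
    · rintro ⟨t, ht⟩
      exact ⟨-t, ht.symm_deck⟩
    · rintro ⟨t, ht⟩
      exact ⟨-t, ht.symm_deck⟩
  | .c i j, .c k l, _, _ => by
    rw [exists_int_iff]
    simp only [arcStart, arcEnd, deck_even_top, deck_odd_top, deck_even_bot, deck_odd_bot,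
      Arc.Crosses]
    have swap : ∀ x y, Cross (P.top i) (P.bot j) (P.bot x) (P.top y) ↔
        (i < y ∧ x < j) ∨ (y < i ∧ j < x) :=
      fun x y => ⟨fun h => P.cross_top_bot_top_bot.1 h.swap_right,
        fun h => (P.cross_top_bot_top_bot.2 h).swap_right⟩
    simp only [swap, cross_top_bot_top_bot, or_assoc]

variable {P} in
lemma isSimplePair_of_valid {a : Arc} (ha : a.Valid n) :
    P.IsSimplePair (P.arcStart a) (P.arcEnd a) where
  left := P.overVertex_arcStart a
  right := P.overVertex_arcEnd a
  ne := by
    cases a with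
    | b i j =>
      intro h
      have := P.top_injective h
      simp only [Arc.Valid] at ha
      lia
    | c i j => exact P.top_ne_bot i j
  not_cross := fun k h => Arc.not_crosses_self ha ((P.exists_cross_iff ha ha).1 ⟨k, h⟩)

lemma arcClass_top_top_eq {i j k l : ℤ}
    (h : arcClass (P.top i) (P.top j) = arcClass (P.top k) (P.top l)) :
    ∃ m : ℤ, (k = i + m * n ∧ l = j + m * n) ∨ (k = j + m * n ∧ l = i + m * n) := by
  obtain ⟨t, ht⟩ := arcClass_eq_arcClass_iff.1 h
  obtain ⟨m, rfl | rfl⟩ := Int.even_or_odd' t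
  · rw [deck_even_top, deck_even_top] at ht
    exact ⟨m, ht.imp (fun h => ⟨P.top_injective h.1, P.top_injective h.2⟩)
      (fun h => ⟨P.top_injective h.1, P.top_injective h.2⟩)⟩
  · rw [deck_odd_top, deck_odd_top] at ht
    rcases ht with ht | ht <;> exact absurd ht.1 (P.top_ne_bot _ _)

lemma arcClass_top_top_ne (i j k l : ℤ) :
    arcClass (P.top i) (P.top j) ≠ arcClass (P.top k) (P.bot l) := by
  intro h
  obtain ⟨t, ht⟩ := arcClass_eq_arcClass_iff.1 h
  obtain ⟨m, rfl | rfl⟩ := Int.even_or_odd' t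
  · rw [deck_even_top, deck_even_top] at ht
    rcases ht with ht | ht <;> exact P.top_ne_bot _ _ ht.2.symm
  · rw [deck_odd_top, deck_odd_top] at ht
    rcases ht with ht | ht <;> exact P.top_ne_bot _ _ ht.1

variable {P} in
lemma IsTrivial.exists_eq {c : CurveClass} (h : P.IsTrivial c) :
    ∃ k l : ℤ, k ≤ l ∧ l ≤ k + 1 ∧ c = arcClass (P.top k) (P.top l) := by
  obtain ⟨k, rfl | rfl⟩ := h
  · exact ⟨k, k, le_rfl, by lia, Joins.classOf_eq ⟨.const I _, fun _ => rfl, rfl, rfl⟩⟩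
  · exact ⟨k, k + 1, by lia, le_rfl, P.bArc_eq k (k + 1)⟩

lemma isArcClass_cls {a : Arc} (ha : a.Valid n) : P.IsArcClass (P.cls a) := by
  refine ⟨fun h => ?_, (isSimplePair_of_valid ha).exists_classOf⟩
  obtain ⟨k, l, h1, h2, h3⟩ := h.exists_eq
  cases a with
  | b i j =>
    obtain ⟨m, hm⟩ := P.arcClass_top_top_eq h3
    simp only [Arc.Valid] at ha
    lia
  | c i j => exact P.arcClass_top_top_ne _ _ _ _ h3.symm

lemma exists_valid_of_isArcClass {c : CurveClass} (hc : P.IsArcClass c) :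
    ∃ a : Arc, a.Valid n ∧ c = P.cls a := by
  obtain ⟨k, q, h, rfl⟩ := hc.exists_isSimplePair
  change P.IsSimplePair (P.top k) q at h
  change P.IsArcClass (arcClass (P.top k) q) at hc
  change ∃ a : Arc, a.Valid n ∧ arcClass (P.top k) q = P.cls a
  have key : ∀ i j, i < j → P.IsArcClass (arcClass (P.top i) (P.top j)) →
      P.IsSimplePair (P.top i) (P.top j) → Arc.Valid n (.b i j) := by
    intro i j hij h1 h2
    refine ⟨?_, ?_⟩
    · by_contra! hcon
      refine h1.1 ⟨i, Or.inr ?_⟩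
      rw [← P.bArc_eq, show j = i + 1 by lia]
      rfl
    · by_contra! hcon
      -- If `j > i + n`, the translate by one turn of the boundary starts strictly inside `(i, j)`
      -- and ends beyond `j`.
      apply h2.not_cross (2 * 1)
      rw [deck_even_top, deck_even_top, P.cross_top_top_top_top hij (by lia)]
      have := (P.strictMono.lt_iff_lt (a := i) (b := i + n)).1 (by rw [P.periodic]; linarith)
      lia
  obtain ⟨l, rfl | rfl⟩ := h.right.eq_top_or_bot
  · rcases lt_trichotomy k l with hkl | rfl | hkl
    · exact ⟨.b k l, key k l hkl hc h, rfl⟩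
    · exact absurd rfl h.ne
    · refine ⟨.b l k, key l k hkl (arcClass_symm _ _ ▸ hc) ⟨h.right, h.left, h.ne.symm, fun t ht =>
        h.not_cross t ht.swap_left.swap_right⟩, arcClass_symm _ _⟩
  · refine ⟨.c k l, ?_, rfl⟩
    -- The nearest odd translates exchange the two lines; not crossing them yields the bounds on `k`
    -- and `l`.
    have h0 := h.not_cross (2 * 0 + 1)
    have h1 := h.not_cross (2 * (-1) + 1)
    rw [deck_odd_bot, deck_odd_top] at h0 h1
    have h0' := fun hh => h0 (Cross.swap_right (P.cross_top_bot_top_bot.2 hh))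
    have h1' := fun hh => h1 (Cross.swap_right (P.cross_top_bot_top_bot.2 hh))
    have := (P.strictMono.lt_iff_lt (a := k) (b := k + n)).1 (by rw [P.periodic]; linarith)
    constructor <;> lia

lemma isArcClass_iff {c : CurveClass} :
    P.IsArcClass c ↔ ∃ a : Arc, a.Valid n ∧ c = P.cls a :=
  ⟨P.exists_valid_of_isArcClass, fun ⟨_, ha, h⟩ => h ▸ P.isArcClass_cls ha⟩

lemma disjointClasses_cls {a a' : Arc} (ha : a.Valid n) (ha' : a'.Valid n)
    (hne : P.cls a ≠ P.cls a') : P.DisjointClasses (P.cls a) (P.cls a') ↔ ¬ a.Crosses n a' := by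
  rw [← P.exists_cross_iff ha ha', not_exists]
  exact ⟨fun h k => h.not_cross k, (isSimplePair_of_valid ha).disjointClasses
    (isSimplePair_of_valid ha') hne⟩

lemma not_crosses_of_cls_eq {a a' : Arc} (ha : a.Valid n) (ha' : a'.Valid n)
    (h : P.cls a = P.cls a') : ¬ a.Crosses n a' := by
  rw [← P.exists_cross_iff ha ha', not_exists]
  intro k hk
  obtain ⟨t, ⟨h1, h2⟩ | ⟨h1, h2⟩⟩ := arcClass_eq_arcClass_iff.1 h
  · rw [h1, h2, ← deck_add, ← deck_add] at hk
    exact (isSimplePair_of_valid ha).not_cross _ hk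
  · rw [h1, h2, ← deck_add, ← deck_add] at hk
    exact (isSimplePair_of_valid ha).not_cross _ hk.swap_right

/-- Symmetry is inherited from the geometric crossing relation, so that no index cases are needed.
-/
lemma crosses_comm (P : Marking n) {a a' : Arc} (ha : a.Valid n) (ha' : a'.Valid n) :
    a.Crosses n a' ↔ a'.Crosses n a := by
  rw [← P.exists_cross_iff ha ha', ← P.exists_cross_iff ha' ha]
  exact ⟨fun ⟨k, hk⟩ => ⟨-k, hk.symm_deck⟩, fun ⟨k, hk⟩ => ⟨-k, hk.symm_deck⟩⟩

lemma cls_b_translate (k l m : ℤ) : P.cls (.b (k + m * n) (l + m * n)) = P.cls (.b k l) := by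
  simp only [cls, arcStart, arcEnd]
  rw [← deck_even_top, ← deck_even_top, arcClass_deck]

lemma cls_c_translate (k l m : ℤ) : P.cls (.c (k + m * n) (l + m * n)) = P.cls (.c k l) := by
  simp only [cls, arcStart, arcEnd]
  rw [← deck_even_top, ← deck_even_bot, arcClass_deck]

lemma cls_c_flip (k l m : ℤ) : P.cls (.c (l + m * n + n) (k + m * n)) = P.cls (.c k l) := by
  simp only [cls, arcStart, arcEnd]
  rw [← deck_odd_bot, ← deck_odd_top, arcClass_deck, arcClass_symm]

lemma cls_b_eq {i j k l : ℤ} (hv : Arc.Valid n (.b i j)) (hv' : Arc.Valid n (.b k l))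
    (h : P.cls (.b i j) = P.cls (.b k l)) : ∃ m : ℤ, k = i + m * n ∧ l = j + m * n := by
  obtain ⟨m, hm⟩ := P.arcClass_top_top_eq h
  simp only [Arc.Valid] at hv hv'
  exact ⟨m, by lia⟩

lemma cls_b_ne_cls_c (i j k l : ℤ) : P.cls (.b i j) ≠ P.cls (.c k l) :=
  P.arcClass_top_top_ne i j k l

end Marking

end Mobius

/-! ### Domination in flag complexes -/

namespace StrongCollapse

variable {V : Type*}

/-- In a flag complex, `v` is dominated by `v'` when `v'` is a neighbour of `v` and of all other
neighbours of `v`. -/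
lemma isDominated_iff_of_flag {X : PreAbstractSimplicialComplex V} {A : V → Prop}
    {D : V → V → Prop} (hD : ∀ c d, D c d → D d c)
    (hX : ∀ s : Finset V, s ∈ X.faces ↔
      s.Nonempty ∧ (∀ c ∈ s, A c) ∧ ∀ c ∈ s, ∀ d ∈ s, c ≠ d → D c d) (v : V) :
    IsDominated X v ↔ A v ∧ ∃ v', v' ≠ v ∧ A v' ∧ D v v' ∧
      ∀ w, A w → w ≠ v → w ≠ v' → D v w → D w v' := by
  classical
  have hlink : ∀ s : Finset V, s ∈ (link X v).faces ↔
      s.Nonempty ∧ v ∉ s ∧ insert v s ∈ X.faces := fun s => by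
    simp only [link, Set.mem_ofPred_eq]
  have hcone : ∀ (L : PreAbstractSimplicialComplex V) (v' : V) (s : Finset V),
      s ∈ (cone v' L).faces ↔ s = {v'} ∨ s ∈ L.faces ∨ ∃ t ∈ L.faces, s = insert v' t :=
    fun L v' s => by
      simp only [cone, Set.mem_ofPred_eq]
  have hsing : ∀ w, {w} ∈ X.faces ↔ A w := fun w => by
    rw [hX]
    refine ⟨fun h => h.2.1 w (by simp), fun h => ⟨by simp, by simpa using h, ?_⟩⟩
    simp +contextual
  constructor
  · rintro ⟨hv, v', hne, hv', L, -, -, hL⟩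
    have hcl : ∀ s, s ∈ (link X v).faces ↔ s ∈ (cone v' L).faces := fun s => by rw [hL]
    refine ⟨(hsing v).1 hv, v', hne, (hsing v').1 hv', ?_, fun w hw hwv hwv' hvw => ?_⟩
    · have h1 := (hlink {v'}).1 ((hcl _).2 ((hcone _ _ _).2 (Or.inl rfl)))
      exact ((hX _).1 h1.2.2).2.2 v (by simp) v' (by simp) hne.symm
    · have h1 : {w} ∈ (link X v).faces := by
        rw [hlink, hX]
        refine ⟨by simp, by simpa using hwv.symm, by simp, ?_, ?_⟩
        · simpa using ⟨(hsing v).1 hv, hw⟩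
        · simp only [Finset.mem_insert, Finset.mem_singleton]
          rintro c (rfl | rfl) d (rfl | rfl) hcd
          · exact absurd rfl hcd
          · exact hvw
          · exact hD _ _ hvw
          · exact absurd rfl hcd
      have h2 : {w} ∈ L.faces := by
        rcases (hcone _ _ _).1 ((hcl _).1 h1) with h | h | ⟨t, ht, h⟩
        · exact absurd (Finset.singleton_injective h) hwv'
        · exact h
        · have : v' ∈ ({w} : Finset V) := h ▸ Finset.mem_insert_self v' t
          exact absurd (Finset.mem_singleton.1 this).symm hwv'
      have h3 := (hlink _).1 ((hcl _).2 ((hcone _ _ _).2 (Or.inr (Or.inr ⟨_, h2, rfl⟩))))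
      exact ((hX _).1 h3.2.2).2.2 w (by simp) v' (by simp) hwv'
  · rintro ⟨hv, v', hne, hv', hD', H⟩
    -- The base of the cone consists of the simplices of the link that avoid `v'`.
    refine ⟨(hsing v).2 hv, v', hne, (hsing v').2 hv',
      ⟨{s | s ∈ (link X v).faces ∧ v' ∉ s}, ?_⟩, ?_, fun h => h.2 (by simp), ?_⟩
    · rintro s ⟨hs, hs'⟩
      have := (link X v).isRelLowerSet_faces hs
      exact ⟨this.1, fun t hts ht => ⟨this.2 hts ht, fun h => hs' (hts h)⟩⟩
    · rintro s ⟨hs, -⟩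
      have := (hlink s).1 hs
      exact (X.isRelLowerSet_faces this.2.2).2 (Finset.subset_insert v s) this.1
    · ext s
      rw [hcone]
      constructor
      · intro hs
        by_cases h : v' ∈ s
        · rcases (s.erase v').eq_empty_or_nonempty with he | he
          · left
            rw [← Finset.insert_erase h, he]
            simp
          · exact Or.inr (Or.inr ⟨s.erase v', ⟨((link X v).isRelLowerSet_faces hs).2
              (Finset.erase_subset _ _) he, by simp⟩, (Finset.insert_erase h).symm⟩)
        · exact Or.inr (Or.inl ⟨hs, h⟩)
      · rintro (rfl | ⟨hs, -⟩ | ⟨t, ⟨ht, htv'⟩, rfl⟩)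
        · rw [hlink, hX]
          refine ⟨by simp, by simpa using hne.symm, by simp, by simpa using ⟨hv, hv'⟩, ?_⟩
          simp only [Finset.mem_insert, Finset.mem_singleton]
          rintro c (rfl | rfl) d (rfl | rfl) hcd
          · exact absurd rfl hcd
          · exact hD'
          · exact hD _ _ hD'
          · exact absurd rfl hcd
        · exact hs
        · obtain ⟨h1, h2, h3⟩ := (hlink t).1 ht
          obtain ⟨h4, h5, h6⟩ := (hX _).1 h3
          have key : ∀ w ∈ insert v t, w ≠ v' → D w v' := by
            intro w hw hwv'
            by_cases hwv : w = v
            · rw [hwv]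
              exact hD'
            · exact H w (h5 w hw) hwv hwv' (h6 v (by simp) w hw (Ne.symm hwv))
          rw [hlink, hX, Finset.insert_comm]
          refine ⟨by simp, by simp [hne.symm, h2], by simp, ?_, ?_⟩
          · intro c hc
            rcases Finset.mem_insert.1 hc with rfl | hc
            · exact hv'
            · exact h5 c hc
          · intro c hc d hd hcd
            rcases Finset.mem_insert.1 hc with rfl | hct <;>
              rcases Finset.mem_insert.1 hd with rfl | hdt
            · exact absurd rfl hcd
            · exact hD _ _ (key d hdt hcd.symm)
            · exact key c hct hcd
            · exact h6 c hct d hdt hcd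

lemma deleteVertices_deleteVertices (X : PreAbstractSimplicialComplex V) (S T : Set V) :
    deleteVertices (deleteVertices X S) T = deleteVertices X (S ∪ T) := by
  ext s
  simp only [deleteVertices, Set.mem_ofPred_eq, Set.mem_union, not_or, and_assoc]
  exact and_congr_right fun _ =>
    ⟨fun h v hv => ⟨h.1 v hv, h.2 v hv⟩, fun h => ⟨fun v hv => (h v hv).1, fun v hv => (h v hv).2⟩⟩

lemma not_isDominated_point (v w : V) : ¬ IsDominated (point v) w := by
  rintro ⟨hw, w', hne, hw', -⟩
  have h1 : w = v := Finset.singleton_injective hw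
  have h2 : w' = v := Finset.singleton_injective hw'
  exact hne (h2.trans h1.symm)

end StrongCollapse

/-! ### Dominated arcs and collapses of the reduced complexes -/

namespace Mobius

namespace Marking

variable {n : ℕ} (P : Marking n)

open StrongCollapse

lemma maximalArc_eq (i : ℤ) : P.maximalArc i = P.cls (.b i (i + n)) := P.bArc_eq _ _

lemma adjacentArc_eq (i : ℤ) : P.adjacentArc i = P.cls (.b (i + 1) (i + n)) := P.bArc_eq _ _

lemma exists_eq_add_mul {i j : ℤ} (h : (i : ZMod n) = j) : ∃ m : ℤ, j = i + m * n := by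
  obtain ⟨m, hm⟩ := (ZMod.intCast_eq_intCast_iff_dvd_sub i j n).1 h
  exact ⟨m, by lia⟩

lemma maximalArc_congr {i j : ℤ} (h : (i : ZMod n) = j) : P.maximalArc i = P.maximalArc j := by
  obtain ⟨m, rfl⟩ := exists_eq_add_mul h
  rw [maximalArc_eq, maximalArc_eq, ← P.cls_b_translate i (i + n) m]
  congr 2
  ring

lemma adjacentArc_congr {i j : ℤ} (h : (i : ZMod n) = j) :
    P.adjacentArc i = P.adjacentArc j := by
  obtain ⟨m, rfl⟩ := exists_eq_add_mul h
  rw [adjacentArc_eq, adjacentArc_eq, ← P.cls_b_translate (i + 1) (i + n) m]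
  congr 2 <;> ring

/-- The arcs that are removed in the complex `reducedComplex`. -/
def removed (I J : Set (ZMod n)) : Set CurveClass :=
  {c | ∃ i : ℤ, (i : ZMod n) ∈ I ∧ c = P.maximalArc i} ∪
    {c | ∃ i : ℤ, (i : ZMod n) ∈ J ∧ c = P.adjacentArc i}

lemma reducedComplex_eq (I J : Set (ZMod n)) :
    P.reducedComplex I J = deleteVertices P.arcComplex (P.removed I J) := rfl

/-- A combinatorial arc whose class is a `0`-simplex of `reducedComplex`. -/
def Present (I J : Set (ZMod n)) (a : Arc) : Prop := a.Valid n ∧ P.cls a ∉ P.removed I J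

variable {P} {I J : Set (ZMod n)}

lemma mem_faces_reducedComplex_iff (s : Finset CurveClass) :
    s ∈ (P.reducedComplex I J).faces ↔ s.Nonempty ∧
      (∀ c ∈ s, P.IsArcClass c ∧ c ∉ P.removed I J) ∧
        ∀ c ∈ s, ∀ d ∈ s, c ≠ d → P.DisjointClasses c d := by
  rw [reducedComplex_eq]
  simp only [deleteVertices, arcComplex, Set.mem_ofPred_eq]
  constructor
  · rintro ⟨⟨h1, h2, h3⟩, h4⟩
    exact ⟨h1, fun c hc => ⟨h2 c hc, h4 c hc⟩, h3⟩
  · rintro ⟨h1, h2, h3⟩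
    exact ⟨⟨h1, fun c hc => (h2 c hc).1, h3⟩, fun c hc => (h2 c hc).2⟩

lemma isDominated_reducedComplex_iff (v : CurveClass) :
    IsDominated (P.reducedComplex I J) v ↔ ∃ a a' : Arc, v = P.cls a ∧ P.Present I J a ∧
      P.Present I J a' ∧ P.cls a' ≠ P.cls a ∧ ¬ a.Crosses n a' ∧
        ∀ w, P.Present I J w → ¬ a.Crosses n w → ¬ w.Crosses n a' := by
  rw [isDominated_iff_of_flag (fun _ _ => DisjointClasses.symm) mem_faces_reducedComplex_iff]
  constructor
  · rintro ⟨⟨hv, hvr⟩, v', hne, ⟨hv', hvr'⟩, hD, H⟩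
    obtain ⟨a, ha, rfl⟩ := P.isArcClass_iff.1 hv
    obtain ⟨a', ha', rfl⟩ := P.isArcClass_iff.1 hv'
    refine ⟨a, a', rfl, ⟨ha, hvr⟩, ⟨ha', hvr'⟩, hne, (P.disjointClasses_cls ha ha' hne.symm).1 hD,
      fun w hw haw => ?_⟩
    -- The combinatorial criterion does not exclude representatives of the classes of `a` and `a'`;
    -- for these the conclusion is automatic.
    by_cases h1 : P.cls w = P.cls a
    · rw [← h1] at hD hne
      exact (P.disjointClasses_cls hw.1 ha' hne.symm).1 hD
    by_cases h2 : P.cls w = P.cls a'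
    · exact P.not_crosses_of_cls_eq hw.1 ha' h2
    · exact (P.disjointClasses_cls hw.1 ha' h2).1 (H _ ⟨P.isArcClass_cls hw.1, hw.2⟩ h1 h2
        ((P.disjointClasses_cls ha hw.1 (Ne.symm h1)).2 haw))
  · rintro ⟨a, a', rfl, ha, ha', hne, hc, H⟩
    refine ⟨⟨P.isArcClass_cls ha.1, ha.2⟩, P.cls a', hne, ⟨P.isArcClass_cls ha'.1, ha'.2⟩,
      (P.disjointClasses_cls ha.1 ha'.1 hne.symm).2 hc, ?_⟩
    rintro c ⟨hc1, hc2⟩ h1 h2 hD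
    obtain ⟨w, hw, rfl⟩ := P.isArcClass_iff.1 hc1
    exact (P.disjointClasses_cls hw ha'.1 h2).2
      (H w ⟨hw, hc2⟩ ((P.disjointClasses_cls ha.1 hw (Ne.symm h1)).1 hD))

/-- This uses `n ≥ 4`: the span `2` of a triangle differs from the spans `n` and `n - 1` of maximal
and adjacent arcs. -/
lemma present_of_short (hn : 4 ≤ n) {w : Arc} (hw : w.Valid n) (hs : w.Short) :
    P.Present I J w := by
  refine ⟨hw, ?_⟩
  cases w with
  | b i j =>
    simp only [Arc.Short] at hs
    rintro (⟨k, -, hk⟩ | ⟨k, -, hk⟩)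
    · rw [maximalArc_eq] at hk
      obtain ⟨m, hm⟩ := P.cls_b_eq hw ⟨by lia, by lia⟩ hk
      lia
    · rw [adjacentArc_eq] at hk
      obtain ⟨m, hm⟩ := P.cls_b_eq hw ⟨by lia, by lia⟩ hk
      lia
  | c i j =>
    rintro (⟨k, -, hk⟩ | ⟨k, -, hk⟩)
    · rw [maximalArc_eq] at hk
      exact P.cls_b_ne_cls_c _ _ _ _ hk.symm
    · rw [adjacentArc_eq] at hk
      exact P.cls_b_ne_cls_c _ _ _ _ hk.symm

lemma present_maximal (hn : 4 ≤ n) {i : ℤ} (hi : (i : ZMod n) ∉ I) :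
    P.Present I J (.b i (i + n)) := by
  have hv : Arc.Valid n (.b i (i + n)) := ⟨by lia, by lia⟩
  refine ⟨hv, ?_⟩
  rintro (⟨k, hkI, hk⟩ | ⟨k, -, hk⟩)
  · rw [maximalArc_eq] at hk
    obtain ⟨m, rfl, -⟩ := P.cls_b_eq hv ⟨by lia, by lia⟩ hk
    simp at hkI
    exact hi hkI
  · rw [adjacentArc_eq] at hk
    obtain ⟨m, hm⟩ := P.cls_b_eq hv ⟨by lia, by lia⟩ hk
    lia

lemma present_adjacent (hn : 4 ≤ n) {i : ℤ} (hi : (i : ZMod n) ∉ J) :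
    P.Present I J (.b (i + 1) (i + n)) := by
  have hv : Arc.Valid n (.b (i + 1) (i + n)) := ⟨by lia, by lia⟩
  refine ⟨hv, ?_⟩
  rintro (⟨k, -, hk⟩ | ⟨k, hkJ, hk⟩)
  · rw [maximalArc_eq] at hk
    obtain ⟨m, hm⟩ := P.cls_b_eq hv ⟨by lia, by lia⟩ hk
    lia
  · rw [adjacentArc_eq] at hk
    obtain ⟨m, hm, -⟩ := P.cls_b_eq hv ⟨by lia, by lia⟩ hk
    obtain rfl : k = i + m * n := by lia
    simp at hkJ
    exact hi hkJ

lemma isDominated_maximalArc (hn : 4 ≤ n) {j : ℤ} (hj : (j : ZMod n) ∉ I) :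
    IsDominated (P.reducedComplex I J) (P.maximalArc j) := by
  have hv : Arc.Valid n (.c j j) := ⟨by lia, by lia⟩
  refine (isDominated_reducedComplex_iff _).2 ⟨.b j (j + n), .c j j, P.maximalArc_eq j,
    present_maximal hn hj, present_of_short hn hv trivial, (P.cls_b_ne_cls_c _ _ _ _).symm,
    Arc.not_crosses_b_loop le_rfl (by lia), fun w hw h => ?_⟩
  rw [P.crosses_comm hw.1 hv]
  exact Arc.not_crosses_loop_of_not_crosses_maximal hw.1 h

lemma isDominated_adjacentArc (hn : 4 ≤ n) {i : ℤ} (hi : (i : ZMod n) ∈ I)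
    (hi' : (i : ZMod n) + 1 ∈ I) (hJ : (i : ZMod n) ∉ J) :
    IsDominated (P.reducedComplex I J) (P.adjacentArc i) := by
  have hv : Arc.Valid n (.c (i + 1) i) := ⟨by lia, by lia⟩
  refine (isDominated_reducedComplex_iff _).2 ⟨.b (i + 1) (i + n), .c (i + 1) i,
    P.adjacentArc_eq i, present_adjacent hn hJ, present_of_short hn hv trivial,
    (P.cls_b_ne_cls_c _ _ _ _).symm, ?_, fun w hw h => ?_⟩
  · rintro ⟨m, hm⟩
    rcases Arc.mul_trichotomy m n with h | h | h <;> lia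
  · rw [P.crosses_comm hw.1 hv]
    refine Arc.not_crosses_c_of_not_crosses_adjacent hw.1 h ?_
    rintro x hx m rfl
    refine hw.2 (Or.inl ⟨x + m * n, ?_, (P.maximalArc_eq _).symm⟩)
    rcases hx with rfl | rfl
    · simpa using hi
    · simpa using hi'

/-- The dominated `0`-simplices of the partially reduced complexes. -/
lemma isDominated_reducedComplex_iff_eq (hn : 4 ≤ n) (v : CurveClass) :
    IsDominated (P.reducedComplex I J) v ↔
      (∃ j : ℤ, (j : ZMod n) ∉ I ∧ v = P.maximalArc j) ∨
      (∃ i : ℤ, (i : ZMod n) ∈ I ∧ (i : ZMod n) + 1 ∈ I ∧ (i : ZMod n) ∉ J ∧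
        v = P.adjacentArc i) := by
  constructor
  · intro h
    obtain ⟨a, a', rfl, ha, ha', hne, hc, H⟩ := (isDominated_reducedComplex_iff v).1 h
    -- Short arcs survive every deletion, so one that is disjoint from `a` and crosses `a'` refutes
    -- domination by `a'`.
    have short : ¬ ∃ w : Arc, w.Valid n ∧ w.Short ∧ ¬ a.Crosses n w ∧ w.Crosses n a' := by
      rintro ⟨w, h1, h2, h3, h4⟩
      exact H w (present_of_short hn h1 h2) h3 h4
    cases a with
    | c i j =>
      refine absurd ?_ short
      cases a' with
      | b k l => exact Arc.exists_short_crosses_c_b hn ha.1 ha'.1 hc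
      | c k l =>
        refine Arc.exists_short_crosses_c_c hn ha.1 ha'.1 hc (fun m hm => hne ?_)
          (fun m hm => hne ?_)
        · rw [hm.1, hm.2, cls_c_translate]
        · rw [hm.1, hm.2, cls_c_flip]
    | b i j =>
      cases a' with
      | b k l =>
        refine absurd (Arc.exists_short_crosses_b_b hn ha.1 ha'.1 hc fun m hm => hne ?_) short
        rw [hm.1, hm.2, cls_b_translate]
      | c k l =>
        by_cases hj : j ≤ i + n - 2
        · exact absurd (Arc.exists_short_crosses_b_c hn ha.1 hj ha'.1) short
        have hv := ha.1
        simp only [Arc.Valid] at hv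
        by_cases hj' : j = i + n
        · subst hj'
          refine Or.inl ⟨i, fun hi => ha.2 (Or.inl ⟨i, hi, ?_⟩), ?_⟩ <;> rw [maximalArc_eq]
        · obtain ⟨t, rfl⟩ : ∃ t, i = t + 1 := ⟨i - 1, by ring⟩
          obtain rfl : j = t + n := by lia
          -- Were `M_x` still present at one of the two outer vertices, either it or the core arc at
          -- the other vertex would cross `a'`.
          have key : ∀ x y : ℤ, (x = t ∧ y = t + 1) ∨ (x = t + 1 ∧ y = t) → (x : ZMod n) ∈ I := by
            intro x y hxy
            by_contra hx
            obtain ⟨w, h1, h2, h3, h4⟩ := Arc.exists_crosses_adjacent_c hn ha'.1 hxy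
            refine H w ?_ h3 h4
            rcases h2 with rfl | h2
            · exact present_maximal hn hx
            · exact present_of_short hn h1 h2
          refine Or.inr ⟨t, key t _ (Or.inl ⟨rfl, rfl⟩), ?_,
            fun hi => ha.2 (Or.inr ⟨t, hi, (P.adjacentArc_eq t).symm⟩), (P.adjacentArc_eq t).symm⟩
          simpa using key (t + 1) _ (Or.inr ⟨rfl, rfl⟩)
  · rintro (⟨j, hj, rfl⟩ | ⟨i, hi, hi', hJ, rfl⟩)
    · exact isDominated_maximalArc hn hj
    · exact isDominated_adjacentArc hn hi hi' hJ

lemma deleteVertices_maximalArc (j : ℤ) : deleteVertices (P.reducedComplex I J) {P.maximalArc j} =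
    P.reducedComplex (insert (j : ZMod n) I) J := by
  rw [reducedComplex_eq, reducedComplex_eq, deleteVertices_deleteVertices]
  congr 1
  ext c
  constructor
  · rintro ((⟨i, hi, rfl⟩ | h) | h)
    · exact Or.inl ⟨i, Or.inr hi, rfl⟩
    · exact Or.inr h
    · exact Or.inl ⟨j, Or.inl rfl, h⟩
  · rintro (⟨i, hi | hi, rfl⟩ | h)
    · exact Or.inr (P.maximalArc_congr hi)
    · exact Or.inl (Or.inl ⟨i, hi, rfl⟩)
    · exact Or.inl (Or.inr h)

lemma deleteVertices_adjacentArc (j : ℤ) :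
    deleteVertices (P.reducedComplex I J) {P.adjacentArc j} =
      P.reducedComplex I (insert (j : ZMod n) J) := by
  rw [reducedComplex_eq, reducedComplex_eq, deleteVertices_deleteVertices]
  congr 1
  ext c
  constructor
  · rintro ((h | ⟨i, hi, rfl⟩) | h)
    · exact Or.inl h
    · exact Or.inr ⟨i, Or.inr hi, rfl⟩
    · exact Or.inr ⟨j, Or.inl rfl, h⟩
  · rintro (h | ⟨i, hi | hi, rfl⟩)
    · exact Or.inl (Or.inl h)
    · exact Or.inr (P.adjacentArc_congr hi)
    · exact Or.inl (Or.inr ⟨i, hi, rfl⟩)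

/-- The complexes obtained from the arc complex by strong collapses. -/
lemma exists_eq_reducedComplex_of_collapsesTo (hn : 4 ≤ n)
    {Y : PreAbstractSimplicialComplex CurveClass} (h : CollapsesTo P.arcComplex Y) :
    ∃ I J : Set (ZMod n), (∀ i ∈ J, i ∈ I ∧ i + 1 ∈ I) ∧ Y = P.reducedComplex I J := by
  induction h with
  | refl =>
    refine ⟨∅, ∅, by simp, ?_⟩
    ext s
    simp [reducedComplex, deleteVertices]
  | tail _ hs ih =>
    obtain ⟨I, J, hIJ, rfl⟩ := ih
    obtain ⟨v, hv, rfl⟩ := hs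
    rcases (isDominated_reducedComplex_iff_eq hn v).1 hv with
      ⟨j, hj, rfl⟩ | ⟨i, hi, hi', hJ, rfl⟩
    · exact ⟨_, J, fun i hi => (hIJ i hi).imp Or.inr Or.inr, deleteVertices_maximalArc j⟩
    · refine ⟨I, _, ?_, deleteVertices_adjacentArc i⟩
      rintro x (rfl | hx)
      · exact ⟨hi, hi'⟩
      · exact hIJ x hx

/-- Remaining maximal arcs are always dominated; when none is left, all remaining adjacent arcs are.
Each deletion lowers the number of indices outside `I` and `J`. -/
lemma reducedComplex_collapsesTo_coreComplex (hn : 4 ≤ n) (I J : Set (ZMod n)) :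
    CollapsesTo (P.reducedComplex I J) P.coreComplex := by
  have : NeZero n := ⟨by lia⟩
  obtain ⟨N, hN⟩ : ∃ N, N = Iᶜ.ncard + Jᶜ.ncard := ⟨_, rfl⟩
  have hlt : ∀ (K : Set (ZMod n)) (x : ZMod n), x ∉ K → (insert x K)ᶜ.ncard < Kᶜ.ncard :=
    fun K x hx => Set.ncard_lt_ncard ⟨Set.compl_subset_compl.2 (Set.subset_insert x K),
      fun h => h hx (Set.mem_insert x K)⟩ (Set.toFinite _)
  induction N using Nat.strong_induction_on generalizing I J with
  | _ N ih =>
    by_cases hI : I = Set.univ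
    · by_cases hJ : J = Set.univ
      · subst hI hJ
        exact Relation.ReflTransGen.refl
      · obtain ⟨x, hx⟩ := (Set.ne_univ_iff_exists_notMem J).1 hJ
        obtain ⟨i, rfl⟩ := ZMod.intCast_surjective x
        refine Relation.ReflTransGen.head ⟨P.adjacentArc i, isDominated_adjacentArc hn
          (by simp [hI]) (by simp [hI]) hx, (deleteVertices_adjacentArc i).symm⟩
          (ih _ ?_ _ _ rfl)
        have := hlt J _ hx
        lia
    · obtain ⟨x, hx⟩ := (Set.ne_univ_iff_exists_notMem I).1 hI
      obtain ⟨i, rfl⟩ := ZMod.intCast_surjective x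
      refine Relation.ReflTransGen.head ⟨P.maximalArc i, isDominated_maximalArc hn hx,
        (deleteVertices_maximalArc i).symm⟩ (ih _ ?_ _ _ rfl)
      have := hlt I _ hx
      lia

lemma not_isDominated_coreComplex (hn : 4 ≤ n) (v : CurveClass) :
    ¬ IsDominated P.coreComplex v := by
  unfold coreComplex
  rw [isDominated_reducedComplex_iff_eq hn]
  simp

lemma coreComplex_ne_point (hn : 4 ≤ n) (v : CurveClass) : P.coreComplex ≠ point v := by
  intro h
  have key : ∀ i : ℤ, P.cls (.c i i) = v := by
    intro i
    have hi : P.Present Set.univ Set.univ (.c i i) :=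
      present_of_short hn ⟨le_rfl, by lia⟩ trivial
    have hf : {P.cls (.c i i)} ∈ P.coreComplex.faces :=
      (mem_faces_reducedComplex_iff _).2 ⟨by simp,
        by simpa using ⟨P.isArcClass_cls hi.1, hi.2⟩, by simp +contextual⟩
    rw [h] at hf
    exact Finset.singleton_injective hf
  -- The core arcs at the vertices `0` and `1` both survive and cross each other, so they are
  -- distinct `0`-simplices.
  refine P.not_crosses_of_cls_eq (a := .c 0 0) (a' := .c 1 1) ⟨le_rfl, by lia⟩ ⟨le_rfl, by lia⟩
    ((key 0).trans (key 1).symm) ⟨-1, ?_⟩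
  lia

lemma collapsesTo_coreComplex (hn : 4 ≤ n) {Y : PreAbstractSimplicialComplex CurveClass}
    (h : CollapsesTo P.arcComplex Y) : CollapsesTo Y P.coreComplex := by
  obtain ⟨I, J, -, rfl⟩ := exists_eq_reducedComplex_of_collapsesTo hn h
  exact reducedComplex_collapsesTo_coreComplex hn I J

lemma eq_coreComplex_of_not_isDominated (hn : 4 ≤ n) {Y : PreAbstractSimplicialComplex CurveClass}
    (h : CollapsesTo P.arcComplex Y) (hY : ∀ v, ¬ IsDominated Y v) : Y = P.coreComplex := by
  -- A nonempty sequence of collapses from `Y` would begin with a dominated `0`-simplex of `Y`.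
  rcases Relation.ReflTransGen.cases_head (collapsesTo_coreComplex hn h) with
    h | ⟨_, ⟨v, hv, -⟩, -⟩
  · exact h
  · exact absurd hv (hY v)

end Marking

end Mobius

theorem mainTheorem3 (n : ℕ) (hn : 4 ≤ n) (P : Mobius.Marking n) :
    ¬ StrongCollapse.StronglyCollapsible P.arcComplex ∧
    (∀ I J : Set (ZMod n), (∀ i ∈ J, i ∈ I ∧ i + 1 ∈ I) →
      ∀ v : Mobius.CurveClass, StrongCollapse.IsDominated (P.reducedComplex I J) v ↔
        (∃ j : ℤ, (j : ZMod n) ∉ I ∧ v = P.maximalArc j) ∨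
        (∃ i : ℤ, (i : ZMod n) ∈ I ∧ (i : ZMod n) + 1 ∈ I ∧ (i : ZMod n) ∉ J ∧
          v = P.adjacentArc i)) ∧
    (∀ Y : PreAbstractSimplicialComplex Mobius.CurveClass,
      StrongCollapse.CollapsesTo P.arcComplex Y →
        StrongCollapse.CollapsesTo Y P.coreComplex ∧
        ((∀ v, ¬ StrongCollapse.IsDominated Y v) → Y = P.coreComplex)) ∧
    (∀ v, ¬ StrongCollapse.IsDominated P.coreComplex v) ∧
    (∀ v, P.coreComplex ≠ StrongCollapse.point v) := by
  refine ⟨?_, fun I J _ v => Mobius.Marking.isDominated_reducedComplex_iff_eq hn v,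
    fun Y hY => ⟨Mobius.Marking.collapsesTo_coreComplex hn hY,
      Mobius.Marking.eq_coreComplex_of_not_isDominated hn hY⟩,
    Mobius.Marking.not_isDominated_coreComplex hn, Mobius.Marking.coreComplex_ne_point hn⟩
  -- A point has no dominated `0`-simplex, so a collapse onto it would make it equal to the core
  -- complex.
  rintro ⟨v, hv⟩
  exact Mobius.Marking.coreComplex_ne_point hn v
    (Mobius.Marking.eq_coreComplex_of_not_isDominated hn hv
      (StrongCollapse.not_isDominated_point v)).symm
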